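/- Let $d \ge 2$ be an integer, let $\Omega \subset \mathbb{R}^d$ be open and bounded, let $p > d$ be a fixed real number and let $g \in W^{1,\infty}(\Omega)$. Let $u$ be a weak solution of $$\Delta_p u := \operatorname{div}\left(|\nabla u|^{p-2}\nabla u\right) = 0 \ \text{in } \Omega, \qquad u = g \ \text{on } \partial\Omega,$$ that is, $u \in W^{1,p}(\Omega)$, $u - g \in W^{1,p}_0(\Omega)$ (the closure of $C_c^\infty(\Omega)$ in $W^{1,p}(\Omega)$), and $$\int_\Omega |\nabla u|^{p-2}\,\nabla u\cdot\nabla v \, dx = 0 \quad \text{for all } v \in W^{1,p}_0(\Omega).$$ Then $u$ is (after modification on a null set) a viscosity solution of $$\Delta_\infty u + \frac{|\nabla u|^2}{p-2}\,\Delta u = 0 \ \text{in } \Omega, \qquad u = g \ \text{on } \partial\Omega, \qquad\text{where } \Delta_\infty u = \sum_{i,j=1}^d \partial_i u\,\partial_j u\,\partial_{ij}^2 u.$$ Explicitly, $u$ and $g$ agree almost everywhere in $\Omega$ with continuous functions on $\Omega$, again denoted $u$ and $g$, such that: 1. for every $x \in \Omega$ and every $\varphi \in C^2(\Omega)$ with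 $\varphi(x) = u(x)$ and $u - \varphi \le 0$ in a neighbourhood of $x$, one has $\Delta_\infty\varphi(x) + \frac{|\nabla\varphi(x)|^2}{p-2}\Delta\varphi(x) \ge 0$; 2. for every $x \in \Omega$ and every $\varphi \in C^2(\Omega)$ with $\varphi(x) = u(x)$ and $u - \varphi \ge 0$ in a neighbourhood of $x$, one has $\Delta_\infty\varphi(x) + \frac{|\nabla\varphi(x)|^2}{p-2}\Delta\varphi(x) \le 0$; 3. for every $y \in \partial\Omega$, $u(x) - g(x) \to 0$ as $x \to y$ with $x \in \Omega$. -/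

import Mathlib

open MeasureTheory Set Filter Topology
open scoped ENNReal ContDiff

noncomputable section

namespace PLaplace

variable {d : ℕ}

/-- The partial derivative `∂ᵢ f (x)` of a function on `ℝᵈ`. -/
def partialDeriv (i : Fin d) (f : EuclideanSpace ℝ (Fin d) → ℝ)
    (x : EuclideanSpace ℝ (Fin d)) : ℝ :=
  fderiv ℝ f x (EuclideanSpace.single i 1)

/-- The Hessian matrix `(∂ᵢ ∂ⱼ f (x))ᵢⱼ`. -/
def hessian (f : EuclideanSpace ℝ (Fin d) → ℝ) (x : EuclideanSpace ℝ (Fin d)) :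
    Matrix (Fin d) (Fin d) ℝ :=
  Matrix.of fun i j => partialDeriv i (partialDeriv j f) x

/-- Smooth functions with compact support contained in `Ω`. -/
def IsTestFunction (Ω : Set (EuclideanSpace ℝ (Fin d)))
    (φ : EuclideanSpace ℝ (Fin d) → ℝ) : Prop :=
  ContDiff ℝ ∞ φ ∧ HasCompactSupport φ ∧ tsupport φ ⊆ Ω

/-- `G` is a weak gradient of `u` in the open set `Ω` (unique up to null sets). -/
def HasWeakGradient (Ω : Set (EuclideanSpace ℝ (Fin d)))
    (u : EuclideanSpace ℝ (Fin d) → ℝ)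
    (G : EuclideanSpace ℝ (Fin d) → EuclideanSpace ℝ (Fin d)) : Prop :=
  LocallyIntegrableOn u Ω ∧ LocallyIntegrableOn G Ω ∧
    ∀ φ : EuclideanSpace ℝ (Fin d) → ℝ, IsTestFunction Ω φ → ∀ i : Fin d,
      ∫ x in Ω, u x * partialDeriv i φ x = -∫ x in Ω, G x i * φ x

/-- The Sobolev space `W^{1,q}(Ω)`, `1 ≤ q ≤ ∞`. -/
def MemSobolev (Ω : Set (EuclideanSpace ℝ (Fin d))) (q : ℝ≥0∞)
    (u : EuclideanSpace ℝ (Fin d) → ℝ) : Prop :=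
  MemLp u q (volume.restrict Ω) ∧
    ∃ G : EuclideanSpace ℝ (Fin d) → EuclideanSpace ℝ (Fin d),
      HasWeakGradient Ω u G ∧ MemLp G q (volume.restrict Ω)

/-- The space `W₀^{1,q}(Ω)`: the closure of the test functions in `W^{1,q}(Ω)`. -/
def MemSobolevZero (Ω : Set (EuclideanSpace ℝ (Fin d))) (q : ℝ≥0∞)
    (u : EuclideanSpace ℝ (Fin d) → ℝ) : Prop :=
  MemLp u q (volume.restrict Ω) ∧
    ∃ G : EuclideanSpace ℝ (Fin d) → EuclideanSpace ℝ (Fin d),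
      HasWeakGradient Ω u G ∧ MemLp G q (volume.restrict Ω) ∧
      ∀ ε : ℝ≥0∞, 0 < ε → ∃ φ : EuclideanSpace ℝ (Fin d) → ℝ, IsTestFunction Ω φ ∧
        eLpNorm (fun x => φ x - u x) q (volume.restrict Ω) < ε ∧
        eLpNorm (fun x => gradient φ x - G x) q (volume.restrict Ω) < ε

/-- The affine space `W_g^{1,q}(Ω)` of the functions in `W^{1,q}(Ω)` that agree with `g` on the
boundary, in the sense that `u - g ∈ W₀^{1,q}(Ω)`. -/
def MemSobolevWithBoundary (Ω : Set (EuclideanSpace ℝ (Fin d))) (q : ℝ≥0∞)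
    (g u : EuclideanSpace ℝ (Fin d) → ℝ) : Prop :=
  MemSobolev Ω q u ∧ MemSobolevZero Ω q (fun x => u x - g x)

/-- Weak solutions of `div (|∇u|^{p-2} ∇u) = 0` in `Ω`, `u = g` on `∂Ω`. -/
def IsWeakSolution (Ω : Set (EuclideanSpace ℝ (Fin d))) (p : ℝ)
    (g u : EuclideanSpace ℝ (Fin d) → ℝ) : Prop :=
  MemSobolevWithBoundary Ω (ENNReal.ofReal p) g u ∧
    ∃ Du : EuclideanSpace ℝ (Fin d) → EuclideanSpace ℝ (Fin d),
      HasWeakGradient Ω u Du ∧ MemLp Du (ENNReal.ofReal p) (volume.restrict Ω) ∧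
      ∀ (v : EuclideanSpace ℝ (Fin d) → ℝ)
        (Dv : EuclideanSpace ℝ (Fin d) → EuclideanSpace ℝ (Fin d)),
        MemSobolevZero Ω (ENNReal.ofReal p) v → HasWeakGradient Ω v Dv →
          ∫ x in Ω, inner ℝ (‖Du x‖ ^ (p - 2) • Du x) (Dv x) = 0

/-- `u` is a viscosity subsolution of `F(u, ∇u, D²u) = 0` at `x`. The sign convention is the usual
one for `F` nonincreasing in the Hessian variable (for example `F = -Δu`). -/
def IsViscositySubsolutionAt (Ω : Set (EuclideanSpace ℝ (Fin d)))
    (F : ℝ → EuclideanSpace ℝ (Fin d) → Matrix (Fin d) (Fin d) ℝ → ℝ)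
    (u : EuclideanSpace ℝ (Fin d) → ℝ) (x : EuclideanSpace ℝ (Fin d)) : Prop :=
  ∀ φ : EuclideanSpace ℝ (Fin d) → ℝ, ContDiffOn ℝ 2 φ Ω → u x = φ x →
    (∀ᶠ y in 𝓝 x, u y - φ y ≤ 0) → F (φ x) (gradient φ x) (hessian φ x) ≤ 0

/-- `u` is a viscosity supersolution of `F(u, ∇u, D²u) = 0` at `x`. -/
def IsViscositySupersolutionAt (Ω : Set (EuclideanSpace ℝ (Fin d)))
    (F : ℝ → EuclideanSpace ℝ (Fin d) → Matrix (Fin d) (Fin d) ℝ → ℝ)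
    (u : EuclideanSpace ℝ (Fin d) → ℝ) (x : EuclideanSpace ℝ (Fin d)) : Prop :=
  ∀ φ : EuclideanSpace ℝ (Fin d) → ℝ, ContDiffOn ℝ 2 φ Ω → u x = φ x →
    (∀ᶠ y in 𝓝 x, 0 ≤ u y - φ y) → 0 ≤ F (φ x) (gradient φ x) (hessian φ x)

/-- Viscosity solutions of `F(u, ∇u, D²u) = 0` in the open set `Ω`. -/
def IsViscositySolution (Ω : Set (EuclideanSpace ℝ (Fin d)))
    (F : ℝ → EuclideanSpace ℝ (Fin d) → Matrix (Fin d) (Fin d) ℝ → ℝ)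
    (u : EuclideanSpace ℝ (Fin d) → ℝ) : Prop :=
  ContinuousOn u Ω ∧
    ∀ x ∈ Ω, IsViscositySubsolutionAt Ω F u x ∧ IsViscositySupersolutionAt Ω F u x

/-- The operator `-(Δ_∞ u + |∇u|² / (p - 2) Δu)` as a function of `ξ = ∇u` and `X = D²u`, where
`Δ_∞ u = ∑ᵢⱼ ∂ᵢu ∂ⱼu ∂ᵢⱼu`. -/
def normalisedOperator (p : ℝ) (_r : ℝ) (ξ : EuclideanSpace ℝ (Fin d))
    (X : Matrix (Fin d) (Fin d) ℝ) : ℝ :=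
  -((∑ i, ∑ j, ξ i * ξ j * X i j) + ‖ξ‖ ^ 2 / (p - 2) * X.trace)

end PLaplace

end

noncomputable section

namespace PLaplace

open scoped Convolution

variable {d : ℕ}

/-! Regularity and boundary values. Since `p > d`, Morrey's inequality
(`exists_enorm_le_mul_eLpNorm_gradient`) bounds the supremum of a test function by the `Lᵖ` norm of
its gradient. Test functions approximating `u - g` are therefore uniformly Cauchy on the whole
space, and their limit is continuous and vanishes off `Ω` (`MemSobolevZero.exists_continuous`). As
`g` is locally Lipschitz up to a null set (`MemSobolev.exists_continuousOn`), adding the two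
representatives gives `u`, and the boundary condition is the continuity of the first one at boundary
points.

Viscosity inequality. Suppose `φ` touches `u` from above at `x₀` with the wrong strict inequality.
Then `∇φ(x₀) ≠ 0`, as the operator vanishes at zero gradient. Adding `|y - x₀|⁴` makes the contact
strict without changing the gradient or Hessian at `x₀`. In nondivergence form the `p`-Laplacian is
a positive multiple of the viscosity operator (`exists_sum_partialDeriv_flux_eq`), so the perturbed
function `ψ` has negative `p`-Laplacian near `x₀`.

Lower `ψ` slightly, so that `w = u - ψ + const` is positive at `x₀` and negative on a small sphere,
and test both equations with `η(w)` inside the ball, where `η` is the smooth transition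
(`false_of_touching`). Monotonicity of `ξ ↦ |ξ|^{p-2} ξ` makes one side nonnegative, while the sign
of the `p`-Laplacian of `ψ` makes the other negative. Mollifying `w` turns `η(w)` into genuine test
functions, so no chain rule for Sobolev functions is needed. Supersolutions follow by replacing `u`
with `-u`. -/

theorem inner_gradient (f : EuclideanSpace ℝ (Fin d) → ℝ) (x y : EuclideanSpace ℝ (Fin d)) :
    inner ℝ (gradient f x) y = fderiv ℝ f x y := by
  simp [gradient]

theorem gradient_apply (f : EuclideanSpace ℝ (Fin d) → ℝ) (x : EuclideanSpace ℝ (Fin d))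
    (i : Fin d) : gradient f x i = partialDeriv i f x := by
  rw [partialDeriv, ← inner_gradient, real_inner_comm, EuclideanSpace.inner_single_left]
  simp

theorem norm_gradient (f : EuclideanSpace ℝ (Fin d) → ℝ) (x : EuclideanSpace ℝ (Fin d)) :
    ‖gradient f x‖ = ‖fderiv ℝ f x‖ := by
  simp [gradient]

theorem integrable_of_continuousOn_of_support_subset {F : Type*} [NormedAddCommGroup F]
    {f : EuclideanSpace ℝ (Fin d) → F} {K : Set (EuclideanSpace ℝ (Fin d))} (hK : IsCompact K)
    (hf : ContinuousOn f K) (h : Function.support f ⊆ K) : Integrable f :=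
  (integrableOn_iff_integrable_of_support_subset h).1 (hf.integrableOn_compact hK)

/-! ### Test functions, integration by parts and weak gradients. -/

namespace IsTestFunction

variable {Ω : Set (EuclideanSpace ℝ (Fin d))} {φ ψ : EuclideanSpace ℝ (Fin d) → ℝ}

theorem eq_zero (hφ : IsTestFunction Ω φ) {x : EuclideanSpace ℝ (Fin d)} (hx : x ∉ Ω) : φ x = 0 :=
  image_eq_zero_of_notMem_tsupport fun h => hx (hφ.2.2 h)

theorem fderiv_eq_zero (hφ : IsTestFunction Ω φ) {x : EuclideanSpace ℝ (Fin d)} (hx : x ∉ Ω) :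
    fderiv ℝ φ x = 0 :=
  image_eq_zero_of_notMem_tsupport fun h => hx (hφ.2.2 (tsupport_fderiv_subset ℝ h))

theorem gradient_eq_zero (hφ : IsTestFunction Ω φ) {x : EuclideanSpace ℝ (Fin d)} (hx : x ∉ Ω) :
    gradient φ x = 0 := by
  simp [gradient, hφ.fderiv_eq_zero hx]

theorem continuous_gradient (hφ : IsTestFunction Ω φ) : Continuous (gradient φ) :=
  (LinearIsometryEquiv.continuous _).comp (hφ.1.continuous_fderiv (by simp))

theorem hasCompactSupport_gradient (hφ : IsTestFunction Ω φ) : HasCompactSupport (gradient φ) :=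
  (hφ.2.1.fderiv ℝ).comp_left (map_zero _)

theorem sub (hφ : IsTestFunction Ω φ) (hψ : IsTestFunction Ω ψ) :
    IsTestFunction Ω (fun x => φ x - ψ x) :=
  ⟨hφ.1.sub hψ.1, hφ.2.1.sub hψ.2.1, (tsupport_sub φ ψ).trans (union_subset hφ.2.2 hψ.2.2)⟩

theorem mono {U : Set (EuclideanSpace ℝ (Fin d))} (hφ : IsTestFunction U φ) (h : U ⊆ Ω) :
    IsTestFunction Ω φ := ⟨hφ.1, hφ.2.1, hφ.2.2.trans h⟩

end IsTestFunction

/-- Integration by parts of a `C¹` function against a test function. -/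
theorem integral_mul_partialDeriv {U : Set (EuclideanSpace ℝ (Fin d))} (hU : IsOpen U)
    {f φ : EuclideanSpace ℝ (Fin d) → ℝ} (hf : ContDiffOn ℝ 1 f U) (hφ : IsTestFunction U φ)
    (i : Fin d) :
    ∫ x in U, f x * partialDeriv i φ x = -∫ x in U, partialDeriv i f x * φ x := by
  have hφ' : Continuous (partialDeriv i φ) :=
    (hφ.1.continuous_fderiv (by simp)).clm_apply continuous_const
  have hf' : ContinuousOn (partialDeriv i f) U :=
    (hf.continuousOn_fderiv_of_isOpen hU le_rfl).clm_apply continuousOn_const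
  have hs : ∀ x ∉ tsupport φ, partialDeriv i φ x = 0 := fun x hx => by
    simp [partialDeriv, image_eq_zero_of_notMem_tsupport
      (fun h => hx (tsupport_fderiv_subset ℝ h) : x ∉ tsupport (fderiv ℝ φ))]
  have hs' : ∀ x ∉ tsupport φ, φ x = 0 := fun x hx => image_eq_zero_of_notMem_tsupport hx
  rw [setIntegral_eq_integral_of_forall_compl_eq_zero
      (fun x hx => by rw [hs x fun h => hx (hφ.2.2 h), mul_zero]),
    setIntegral_eq_integral_of_forall_compl_eq_zero
      (fun x hx => by rw [hs' x fun h => hx (hφ.2.2 h), mul_zero])]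
  refine integral_mul_fderiv_eq_neg_fderiv_mul_of_integrable ?_ ?_ ?_ ?_ ?_
  · refine integrable_of_continuousOn_of_support_subset hφ.2.1
      ((hf'.mono hφ.2.2).mul hφ.1.continuous.continuousOn) fun x hx => ?_
    contrapose! hx
    simp [hs' x hx]
  · refine integrable_of_continuousOn_of_support_subset hφ.2.1
      ((hf.continuousOn.mono hφ.2.2).mul hφ'.continuousOn) fun x hx => ?_
    contrapose! hx
    rw [Function.notMem_support]
    exact mul_eq_zero_of_right _ (hs x hx)
  · refine integrable_of_continuousOn_of_support_subset hφ.2.1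
      ((hf.continuousOn.mono hφ.2.2).mul hφ.1.continuous.continuousOn) fun x hx => ?_
    contrapose! hx
    simp [hs' x hx]
  · exact fun x hx => (hf.differentiableOn one_ne_zero).differentiableAt (hU.mem_nhds (hφ.2.2 hx))
  · exact fun x _ => hφ.1.contDiffAt.differentiableAt (by simp)

theorem hasWeakGradient_of_contDiffOn {U : Set (EuclideanSpace ℝ (Fin d))} (hU : IsOpen U)
    {f : EuclideanSpace ℝ (Fin d) → ℝ} (hf : ContDiffOn ℝ 1 f U) :
    HasWeakGradient U f (gradient f) := by
  refine ⟨hf.continuousOn.locallyIntegrableOn hU.measurableSet, ?_, fun φ hφ i => ?_⟩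
  · exact ((LinearIsometryEquiv.continuous _).comp_continuousOn
      (hf.continuousOn_fderiv_of_isOpen hU le_rfl)).locallyIntegrableOn hU.measurableSet
  · simp_rw [gradient_apply]
    exact integral_mul_partialDeriv hU hf hφ i

theorem IsTestFunction.memSobolevZero {Ω : Set (EuclideanSpace ℝ (Fin d))} (hΩ : IsOpen Ω)
    {φ : EuclideanSpace ℝ (Fin d) → ℝ} (hφ : IsTestFunction Ω φ) (q : ℝ≥0∞) :
    MemSobolevZero Ω q φ :=
  ⟨(hφ.1.continuous.memLp_of_hasCompactSupport hφ.2.1).restrict Ω, gradient φ,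
    hasWeakGradient_of_contDiffOn hΩ (hφ.1.of_le (by simp)).contDiffOn,
    (hφ.continuous_gradient.memLp_of_hasCompactSupport hφ.hasCompactSupport_gradient).restrict Ω,
    fun ε hε => ⟨φ, hφ, by simpa using hε, by simpa using hε⟩⟩

theorem HasWeakGradient.congr_ae {Ω : Set (EuclideanSpace ℝ (Fin d))}
    {u v : EuclideanSpace ℝ (Fin d) → ℝ}
    {G : EuclideanSpace ℝ (Fin d) → EuclideanSpace ℝ (Fin d)} (h : HasWeakGradient Ω u G)
    (huv : u =ᵐ[volume.restrict Ω] v) (hv : LocallyIntegrableOn v Ω) : HasWeakGradient Ω v G :=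
  ⟨hv, h.2.1, fun φ hφ i => by
    rw [← h.2.2 φ hφ i]
    refine integral_congr_ae ?_
    filter_upwards [huv] with x hx
    rw [hx]⟩

theorem HasWeakGradient.neg {Ω : Set (EuclideanSpace ℝ (Fin d))}
    {u : EuclideanSpace ℝ (Fin d) → ℝ}
    {G : EuclideanSpace ℝ (Fin d) → EuclideanSpace ℝ (Fin d)} (h : HasWeakGradient Ω u G) :
    HasWeakGradient Ω (-u) (-G) :=
  ⟨h.1.neg, h.2.1.neg, fun φ hφ i => by
    simpa [integral_neg] using congrArg Neg.neg (h.2.2 φ hφ i)⟩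

/-! ### Morrey's inequality for `p > d`. -/

theorem eLpNorm_comp_add_smul {F : Type*} [NormedAddCommGroup F]
    {f : EuclideanSpace ℝ (Fin d) → F} (hf : Continuous f) {p : ℝ} (hp : 0 < p)
    (x : EuclideanSpace ℝ (Fin d)) {t : ℝ} (ht : 0 < t) :
    eLpNorm (fun y => f (x + t • y)) (ENNReal.ofReal p) volume =
      ENNReal.ofReal (t ^ (-(d / p))) * eLpNorm f (ENNReal.ofReal p) volume := by
  have h1 : Measure.map (fun y => x + t • y) (volume : Measure (EuclideanSpace ℝ (Fin d))) =
      ENNReal.ofReal (t ^ d)⁻¹ • volume := by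
    have : (fun y => x + t • y) = (fun y => x + y) ∘ (fun y : EuclideanSpace ℝ (Fin d) => t • y) :=
      rfl
    rw [this, ← Measure.map_map (by fun_prop) (by fun_prop), Measure.map_addHaar_smul _ ht.ne',
      Measure.map_smul, map_add_left_eq_self, finrank_euclideanSpace_fin,
      abs_of_pos (by positivity)]
  have h2 := eLpNorm_map_measure (p := ENNReal.ofReal p) (g := f)
    (f := fun y => x + t • y) (μ := volume) hf.aestronglyMeasurable (by fun_prop)
  rw [Function.comp_def] at h2
  rw [← h2, h1, eLpNorm_smul_measure_of_ne_zero (by simpa using pow_pos ht d), smul_eq_mul,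
    ENNReal.toReal_div, ENNReal.toReal_one, ENNReal.toReal_ofReal hp.le,
    ENNReal.ofReal_rpow_of_pos (by positivity)]
  congr 2
  rw [← Real.rpow_natCast, ← Real.rpow_neg ht.le, ← Real.rpow_mul ht.le]
  congr 1
  ring

/-- Fundamental theorem of calculus along a ray: `2R‖y‖ - ‖x‖ ≥ R`, so the endpoint has left `Ω` and
`φ` vanishes there. The factor `2` in the integrand bounds `‖y‖`. -/
theorem IsTestFunction.enorm_le_lintegral_segment {Ω : Set (EuclideanSpace ℝ (Fin d))}
    {φ : EuclideanSpace ℝ (Fin d) → ℝ} (hφ : IsTestFunction Ω φ) {R : ℝ} (hR : 0 ≤ R)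
    (hΩ : Ω ⊆ Metric.ball 0 R) {x y : EuclideanSpace ℝ (Fin d)} (hx : x ∈ Ω)
    (hy1 : 1 ≤ ‖y‖) (hy2 : ‖y‖ ≤ 2) :
    ‖φ x‖ₑ ≤ ∫⁻ t in Ioc 0 (2 * R), 2 * ‖gradient φ (x + t • y)‖ₑ := by
  have h0 : φ (x + (2 * R) • y) = 0 := by
    refine hφ.eq_zero fun h => ?_
    have h1 := hΩ h
    have h2 := hΩ hx
    rw [mem_ball_zero_iff] at h1 h2
    have h3 : ‖(2 * R) • y‖ ≤ ‖x + (2 * R) • y‖ + ‖x‖ := by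
      simpa using norm_sub_le (x + (2 * R) • y) x
    rw [norm_smul, Real.norm_of_nonneg (by positivity)] at h3
    nlinarith
  have hd : ∀ t : ℝ, HasDerivAt (fun t : ℝ => φ (x + t • y)) (fderiv ℝ φ (x + t • y) y) t := by
    intro t
    have h1 : HasFDerivAt φ (fderiv ℝ φ (x + t • y)) (x + t • y) :=
      (hφ.1.contDiffAt.differentiableAt (by simp)).hasFDerivAt
    have h2 : HasDerivAt (fun t : ℝ => x + t • y) y t := by
      simpa using ((hasDerivAt_id t).smul_const y).const_add x
    exact h1.comp_hasDerivAt t h2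
  have hc : Continuous fun t : ℝ => fderiv ℝ φ (x + t • y) y :=
    ((hφ.1.continuous_fderiv (by simp)).comp (by fun_prop)).clm_apply continuous_const
  have hi := intervalIntegral.integral_eq_sub_of_hasDerivAt (fun t _ => hd t)
    (hc.intervalIntegrable 0 (2 * R))
  rw [h0, zero_smul, add_zero, zero_sub, intervalIntegral.integral_of_le (by positivity)] at hi
  rw [← enorm_neg, ← hi]
  refine (enorm_integral_le_lintegral_enorm _).trans (lintegral_mono fun t => ?_)
  rw [mul_comm, ← ofReal_norm (gradient φ _), norm_gradient, ofReal_norm]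
  refine (ContinuousLinearMap.le_opENorm _ _).trans ?_
  gcongr
  rw [← ofReal_norm]
  exact (ENNReal.ofReal_le_ofReal hy2).trans (by simp)

/-- **Morrey's inequality** for test functions: the supremum is controlled by the `Lᵖ` norm of the
gradient when `p > d`. -/
theorem exists_enorm_le_mul_eLpNorm_gradient {Ω : Set (EuclideanSpace ℝ (Fin d))}
    (hΩb : Bornology.IsBounded Ω) (hd : 2 ≤ d) {p : ℝ} (hp : (d : ℝ) < p) :
    ∃ C : ℝ≥0∞, C ≠ ⊤ ∧ ∀ φ : EuclideanSpace ℝ (Fin d) → ℝ, IsTestFunction Ω φ → ∀ x,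
      ‖φ x‖ₑ ≤ C * eLpNorm (gradient φ) (ENNReal.ofReal p) (volume.restrict Ω) := by
  have hd' : (2 : ℝ) ≤ d := by exact_mod_cast hd
  have hp0 : 0 < p := by linarith
  obtain ⟨R, hR, hΩR⟩ : ∃ R : ℝ, 0 < R ∧ Ω ⊆ Metric.ball 0 R := by
    obtain ⟨R, hR⟩ := hΩb.subset_ball 0
    exact ⟨max R 1, by positivity, hR.trans (Metric.ball_subset_ball (le_max_left _ _))⟩
  -- The ray bound will be averaged over directions in this annulus, on which `1 < ‖y‖ < 2`.
  set A : Set (EuclideanSpace ℝ (Fin d)) := Metric.ball 0 2 ∩ (Metric.closedBall 0 1)ᶜ with hA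
  have hAo : IsOpen A := Metric.isOpen_ball.inter Metric.isClosed_closedBall.isOpen_compl
  have hA0 : volume A ≠ 0 := by
    refine (hAo.measure_pos volume ⟨EuclideanSpace.single ⟨0, by omega⟩ (3 / 2), ?_⟩).ne'
    constructor <;> simp <;> norm_num
  have hAt : volume A ≠ ⊤ := (Metric.isBounded_ball.subset inter_subset_left).measure_lt_top.ne
  have : Fact (volume A < ⊤) := ⟨hAt.lt_top⟩
  set K : ℝ≥0∞ := ∫⁻ t in Ioc 0 (2 * R), ENNReal.ofReal (t ^ (-(d / p))) with hK
  have hKt : K ≠ ⊤ := by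
    -- This is where `p > d` enters: the scaling factor `t ^ (-d/p)` is integrable at `0`.
    have h1 : -1 < -(d / p) := by
      rw [neg_lt_neg_iff, div_lt_one hp0]; exact hp
    have h2 := (intervalIntegral.intervalIntegrable_rpow' (a := 0) (b := 2 * R) h1).1
    exact (h2.lintegral_lt_top).ne
  set r : ℝ := 1 / (1 : ℝ≥0∞).toReal - 1 / (ENNReal.ofReal p).toReal with hr
  have hr0 : 0 ≤ r := by
    rw [hr, ENNReal.toReal_ofReal hp0.le]
    simp only [ENNReal.toReal_one, div_one, sub_nonneg, one_div]
    exact inv_le_one_of_one_le₀ (by linarith)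
  refine ⟨(volume A)⁻¹ * (2 * (volume A) ^ r * K), ?_, fun φ hφ x => ?_⟩
  · exact ENNReal.mul_ne_top (by simpa using hA0) (ENNReal.mul_ne_top (ENNReal.mul_ne_top (by simp)
      (ENNReal.rpow_ne_top_of_nonneg hr0 hAt)) hKt)
  by_cases hx : x ∈ Ω
  swap
  · simp [hφ.eq_zero hx]
  set N := eLpNorm (gradient φ) (ENNReal.ofReal p) (volume.restrict Ω) with hN
  have hN' : eLpNorm (gradient φ) (ENNReal.ofReal p) volume = N := by
    rw [hN, eLpNorm_restrict_eq_of_support_subset]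
    intro y hy
    by_contra h
    exact hy (hφ.gradient_eq_zero h)
  have hcont := hφ.continuous_gradient
  have h1 : volume A * ‖φ x‖ₑ ≤ 2 * (volume A) ^ r * K * N := calc
    volume A * ‖φ x‖ₑ = ∫⁻ y in A, ‖φ x‖ₑ := by rw [setLIntegral_const, mul_comm]
    _ ≤ ∫⁻ y in A, ∫⁻ t in Ioc 0 (2 * R), 2 * ‖gradient φ (x + t • y)‖ₑ := by
      refine setLIntegral_mono' hAo.measurableSet fun y hy => ?_
      rw [hA, mem_inter_iff, mem_compl_iff, mem_ball_zero_iff, mem_closedBall_zero_iff] at hy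
      exact hφ.enorm_le_lintegral_segment hR.le hΩR hx (not_le.1 hy.2).le hy.1.le
    _ = ∫⁻ t in Ioc 0 (2 * R), ∫⁻ y in A, 2 * ‖gradient φ (x + t • y)‖ₑ := by
      refine lintegral_lintegral_swap (Continuous.aemeasurable ?_)
      have : Continuous fun z : EuclideanSpace ℝ (Fin d) × ℝ => gradient φ (x + z.2 • z.1) :=
        hcont.comp (by fun_prop)
      exact (ENNReal.continuous_const_mul (by simp)).comp this.enorm
    -- For fixed `t`, Hölder on `A` passes from `L¹` to `Lᵖ` at the cost `(volume A) ^ (1 - 1/p)`;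
    -- then `y ↦ x + t • y` is undone by scaling.
    _ ≤ ∫⁻ t in Ioc 0 (2 * R), 2 * (volume A) ^ r * N * ENNReal.ofReal (t ^ (-(d / p))) := by
      refine setLIntegral_mono' measurableSet_Ioc fun t ht => ?_
      have hc' : Continuous fun y => gradient φ (x + t • y) := hcont.comp (by fun_prop)
      have h2 := eLpNorm_le_eLpNorm_mul_rpow_measure_univ (p := 1) (q := ENNReal.ofReal p)
        (μ := volume.restrict A) (by simpa using by linarith) hc'.aestronglyMeasurable
      rw [eLpNorm_one_eq_lintegral_enorm, Measure.restrict_apply_univ] at h2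
      have h3 := (eLpNorm_restrict_le (fun y => gradient φ (x + t • y)) (ENNReal.ofReal p)
        volume A).trans_eq (eLpNorm_comp_add_smul hcont hp0 x ht.1)
      rw [hN'] at h3
      rw [lintegral_const_mul _ hc'.enorm.measurable]
      calc _ ≤ 2 * (ENNReal.ofReal (t ^ (-(d / p))) * N * volume A ^ r) := by
            gcongr
            exact h2.trans (by gcongr)
        _ = _ := by ring
    _ = 2 * (volume A) ^ r * K * N := by
      rw [lintegral_const_mul _ (by fun_prop)]
      ring
  rw [mul_assoc, ← ENNReal.div_eq_inv_mul]
  rw [ENNReal.le_div_iff_mul_le (Or.inl hA0) (Or.inl hAt), mul_comm]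
  exact h1

/-! ### Mollification. -/

theorem eLpNorm_convolution_normed_le {F : Type*} [NormedAddCommGroup F] [NormedSpace ℝ F]
    (ρ : ContDiffBump (0 : EuclideanSpace ℝ (Fin d))) {f : EuclideanSpace ℝ (Fin d) → F}
    (hf : AEStronglyMeasurable f volume) {p : ℝ} (hp : 1 ≤ p) :
    eLpNorm (ρ.normed volume ⋆[ContinuousLinearMap.lsmul ℝ ℝ, volume] f) (ENNReal.ofReal p)
      volume ≤ eLpNorm f (ENNReal.ofReal p) volume := by
  have hp0 : 0 < p := by linarith
  -- Tonelli below needs joint measurability of `(x, t) ↦ f (x - t)`; changing `f` on a null set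
  -- affects neither side.
  wlog hfm : StronglyMeasurable f generalizing f
  · have h := this (f := hf.mk f) hf.stronglyMeasurable_mk.aestronglyMeasurable
      hf.stronglyMeasurable_mk
    rwa [← eLpNorm_congr_ae hf.ae_eq_mk, ← convolution_congr (ContinuousLinearMap.lsmul ℝ ℝ)
      (ae_eq_refl _) hf.ae_eq_mk] at h
  have hρm : Measurable fun t => ENNReal.ofReal (ρ.normed volume t) :=
    (ENNReal.continuous_ofReal.comp ρ.continuous_normed).measurable
  -- The kernel is a probability density, so Jensen's inequality is the monotonicity in the exponent
  -- of `Lᵖ` norms for `P`.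
  set P : Measure (EuclideanSpace ℝ (Fin d)) :=
    volume.withDensity fun t => ENNReal.ofReal (ρ.normed volume t) with hP
  have : IsProbabilityMeasure P := ⟨by
    rw [hP, withDensity_apply _ MeasurableSet.univ, Measure.restrict_univ,
      ← ofReal_integral_eq_lintegral_ofReal ρ.integrable_normed
        (ae_of_all _ ρ.nonneg_normed), ρ.integral_normed, ENNReal.ofReal_one]⟩
  have hq : (ENNReal.ofReal p) ≠ 0 := by simpa using hp0
  have key : ∀ x, ‖(ρ.normed volume ⋆[ContinuousLinearMap.lsmul ℝ ℝ, volume] f) x‖ₑ ^ p ≤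
      ∫⁻ t, ‖f (x - t)‖ₑ ^ p ∂P := by
    intro x
    have hm : StronglyMeasurable fun t => f (x - t) := hfm.comp_measurable (by fun_prop)
    have h1 : ‖(ρ.normed volume ⋆[ContinuousLinearMap.lsmul ℝ ℝ, volume] f) x‖ₑ ≤
        ∫⁻ t, ‖f (x - t)‖ₑ ∂P := by
      rw [hP, lintegral_withDensity_eq_lintegral_mul _ hρm hm.enorm]
      refine (enorm_integral_le_lintegral_enorm _).trans (lintegral_mono fun t => ?_)
      simp [enorm_smul, Real.enorm_of_nonneg (ρ.nonneg_normed t)]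
    have h2 := eLpNorm_le_eLpNorm_of_exponent_le (p := 1) (q := ENNReal.ofReal p) (μ := P)
      (by simpa using hp) hm.aestronglyMeasurable
    rw [eLpNorm_one_eq_lintegral_enorm, eLpNorm_eq_lintegral_rpow_enorm_toReal hq (by simp),
      ENNReal.toReal_ofReal hp0.le] at h2
    calc _ ≤ ((∫⁻ t, ‖f (x - t)‖ₑ ^ p ∂P) ^ (1 / p)) ^ p := by
          gcongr
          exact h1.trans h2
      _ = _ := by rw [← ENNReal.rpow_mul, one_div_mul_cancel hp0.ne', ENNReal.rpow_one]
  rw [eLpNorm_eq_lintegral_rpow_enorm_toReal hq (by simp),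
    eLpNorm_eq_lintegral_rpow_enorm_toReal hq (by simp), ENNReal.toReal_ofReal hp0.le]
  refine ENNReal.rpow_le_rpow ?_ (by positivity)
  calc _ ≤ ∫⁻ x, ∫⁻ t, ‖f (x - t)‖ₑ ^ p ∂P := lintegral_mono key
    _ = ∫⁻ t, (∫⁻ x, ‖f (x - t)‖ₑ ^ p) ∂P := by
      refine lintegral_lintegral_swap (Measurable.aemeasurable ?_)
      have : StronglyMeasurable fun z : EuclideanSpace ℝ (Fin d) × EuclideanSpace ℝ (Fin d) =>
        f (z.1 - z.2) := hfm.comp_measurable (by fun_prop)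
      exact this.enorm.pow_const p
    _ = ∫⁻ t, (∫⁻ x, ‖f x‖ₑ ^ p) ∂P := by
      refine lintegral_congr fun t => ?_
      exact lintegral_sub_right_eq_self (fun x => ‖f x‖ₑ ^ p) t
    _ = _ := by simp

/-- A standard sequence of mollifiers. -/
def mollifier (d n : ℕ) : ContDiffBump (0 : EuclideanSpace ℝ (Fin d)) where
  rIn := 1 / (n + 1)
  rOut := 2 / (n + 1)
  rIn_pos := by positivity
  rIn_lt_rOut := by gcongr; norm_num

theorem tendsto_mollifier_rOut : Tendsto (fun n => (mollifier d n).rOut) atTop (𝓝 0) := by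
  have h := (tendsto_one_div_add_atTop_nhds_zero_nat (𝕜 := ℝ)).const_mul 2
  simpa [mollifier, mul_one_div, div_eq_mul_inv] using h

/-- The mollification of `f` at scale `2 / (n + 1)`. -/
def mollify {F : Type*} [NormedAddCommGroup F] [NormedSpace ℝ F] (n : ℕ)
    (f : EuclideanSpace ℝ (Fin d) → F) : EuclideanSpace ℝ (Fin d) → F :=
  (mollifier d n).normed volume ⋆[ContinuousLinearMap.lsmul ℝ ℝ, volume] f

/-- Convergence is joint in the scale and the point, which is what yields uniform convergence on
compact sets. -/
theorem tendsto_mollify_nhds {F : Type*} [NormedAddCommGroup F] [NormedSpace ℝ F]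
    [CompleteSpace F]
    {f : EuclideanSpace ℝ (Fin d) → F} (hf : AEStronglyMeasurable f volume)
    {x₀ : EuclideanSpace ℝ (Fin d)} (hx₀ : ContinuousAt f x₀) :
    Tendsto (fun z : ℕ × EuclideanSpace ℝ (Fin d) => mollify z.1 f z.2) (atTop ×ˢ 𝓝 x₀)
      (𝓝 (f x₀)) :=
  ContDiffBump.convolution_tendsto_right (φ := fun z : ℕ × EuclideanSpace ℝ (Fin d) =>
      mollifier d z.1) (g := fun _ => f) (k := fun z => z.2)
    (tendsto_mollifier_rOut.comp tendsto_fst) (Eventually.of_forall fun _ => hf)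
    (hx₀.tendsto.comp tendsto_snd) tendsto_snd

theorem tendstoUniformlyOn_mollify {F : Type*} [NormedAddCommGroup F] [NormedSpace ℝ F]
    [CompleteSpace F]
    {f : EuclideanSpace ℝ (Fin d) → F} (hf : AEStronglyMeasurable f volume)
    {K : Set (EuclideanSpace ℝ (Fin d))} (hK : IsCompact K) (hfK : ∀ x ∈ K, ContinuousAt f x) :
    TendstoUniformlyOn (fun n => mollify n f) f atTop K := by
  rw [← tendstoLocallyUniformlyOn_iff_tendstoUniformlyOn_of_compact hK,
    tendstoLocallyUniformlyOn_iff_forall_tendsto]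
  intro x hx
  have h1 : Tendsto (fun z : ℕ × EuclideanSpace ℝ (Fin d) => (f z.2, mollify z.1 f z.2))
      (atTop ×ˢ 𝓝 x) (𝓝 (f x, f x)) := by
    rw [nhds_prod_eq]
    exact ((hfK x hx).tendsto.comp tendsto_snd).prodMk (tendsto_mollify_nhds hf (hfK x hx))
  exact (h1.mono_left (Filter.prod_mono le_rfl nhdsWithin_le_nhds)).mono_right
    (nhds_le_uniformity _)

theorem ae_tendsto_mollify {F : Type*} [NormedAddCommGroup F] [NormedSpace ℝ F]
    [CompleteSpace F] {f : EuclideanSpace ℝ (Fin d) → F} (hf : LocallyIntegrable f volume) :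
    ∀ᵐ x, Tendsto (fun n => mollify n f x) atTop (𝓝 (f x)) :=
  -- Lebesgue differentiation needs a bounded ratio of outer to inner radius; here it is `2`.
  ContDiffBump.ae_convolution_tendsto_right_of_locallyIntegrable (K := 2) tendsto_mollifier_rOut
    (Eventually.of_forall fun n => by simp [mollifier, div_eq_mul_inv]) hf

theorem contDiff_mollify {F : Type*} [NormedAddCommGroup F] [NormedSpace ℝ F]
    {f : EuclideanSpace ℝ (Fin d) → F} (hf : LocallyIntegrable f volume) (n : ℕ) :
    ContDiff ℝ ∞ (mollify n f) :=
  (mollifier d n).hasCompactSupport_normed.contDiff_convolution_left _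
    ((mollifier d n).contDiff_normed (n := ⊤)) hf

theorem convolutionExists_mollify {F : Type*} [NormedAddCommGroup F] [NormedSpace ℝ F]
    {f : EuclideanSpace ℝ (Fin d) → F} (hf : LocallyIntegrable f volume) (n : ℕ) :
    ConvolutionExists ((mollifier d n).normed volume) f (ContinuousLinearMap.lsmul ℝ ℝ) volume :=
  (mollifier d n).hasCompactSupport_normed.convolutionExists_left _
    (mollifier d n).continuous_normed hf

/-- Mollifications converge in `Lᵖ`. -/
theorem tendsto_eLpNorm_mollify_sub {F : Type*} [NormedAddCommGroup F] [NormedSpace ℝ F]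
    [CompleteSpace F] {f : EuclideanSpace ℝ (Fin d) → F} {p : ℝ} (hp : 1 ≤ p)
    (hf : MemLp f (ENNReal.ofReal p) volume) :
    Tendsto (fun n => eLpNorm (fun x => mollify n f x - f x) (ENNReal.ofReal p) volume) atTop
      (𝓝 0) := by
  have hp1 : 1 ≤ ENNReal.ofReal p := by simpa using hp
  rw [ENNReal.tendsto_nhds_zero]
  intro ε hε
  have hε3 : ε / 3 ≠ 0 := by simpa using hε.ne'
  obtain ⟨g, hgc, hfg, hg, hgm⟩ := hf.exists_hasCompactSupport_eLpNorm_sub_le (by simp) hε3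
  have hfl := hf.locallyIntegrable hp1
  have hgl := hgm.locallyIntegrable hp1
  -- All mollifiers have radius at most `2`, attained at `n = 0`, so every `mollify n g` vanishes
  -- off `K`.
  set K := Metric.cthickening 2 (tsupport g) with hK
  have hKc : IsCompact K := hgc.cthickening
  have hμK : volume K ^ (ENNReal.ofReal p).toReal⁻¹ ≠ ⊤ :=
    ENNReal.rpow_ne_top_of_nonneg (by positivity) hKc.measure_lt_top.ne
  obtain ⟨δ, hδ, hδε⟩ : ∃ δ : ℝ, 0 < δ ∧
      volume K ^ (ENNReal.ofReal p).toReal⁻¹ * ENNReal.ofReal δ ≤ ε / 3 := by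
    have h1 : Tendsto (fun δ : ℝ => volume K ^ (ENNReal.ofReal p).toReal⁻¹ * ENNReal.ofReal δ)
        (𝓝[>] 0) (𝓝 (volume K ^ (ENNReal.ofReal p).toReal⁻¹ * ENNReal.ofReal 0)) :=
      ENNReal.Tendsto.const_mul ((ENNReal.continuous_ofReal.tendsto 0).mono_left
        nhdsWithin_le_nhds) (Or.inr hμK)
    rw [ENNReal.ofReal_zero, mul_zero] at h1
    obtain ⟨δ, h2, h3⟩ := ((h1.eventually_le_const (pos_iff_ne_zero.2 hε3)).and
      self_mem_nhdsWithin).exists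
    exact ⟨δ, h3, h2⟩
  have hu := tendstoUniformlyOn_mollify hg.aestronglyMeasurable hKc
    fun x _ => hg.continuousAt
  filter_upwards [Metric.tendstoUniformlyOn_iff.1 hu δ hδ] with n hn
  have hout : ∀ x ∉ K, mollify n g x - g x = 0 := by
    intro x hx
    have hx' : ∀ y ∈ Metric.closedBall x 2, g y = 0 := by
      intro y hy
      refine image_eq_zero_of_notMem_tsupport fun h => hx ?_
      exact Metric.mem_cthickening_of_dist_le x y 2 _ h (by rwa [Metric.mem_closedBall'] at hy)
    have hr : (mollifier d n).rOut ≤ 2 := by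
      simp only [mollifier]
      rw [div_le_iff₀ (by positivity)]
      nlinarith [(Nat.cast_nonneg n : (0 : ℝ) ≤ n)]
    have h0 := hx' x (Metric.mem_closedBall_self (by norm_num))
    rw [mollify, ContDiffBump.normed_convolution_eq_right fun y hy => ?_, sub_self]
    rw [h0]
    exact hx' y ((Metric.ball_subset_closedBall.trans (Metric.closedBall_subset_closedBall hr)) hy)
  have h1 : eLpNorm (fun x => mollify n g x - g x) (ENNReal.ofReal p) volume ≤ ε / 3 := by
    rw [← eLpNorm_restrict_eq_of_support_subset (s := K)
      fun x hx => by_contra fun h => hx (hout x h)]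
    refine (eLpNorm_le_of_ae_bound (C := δ) ?_).trans (by simpa using hδε)
    filter_upwards [ae_restrict_mem hKc.measurableSet] with x hx
    rw [← dist_eq_norm, dist_comm]
    exact (hn x hx).le
  -- The three pieces are controlled by Young's inequality, uniform convergence for `g`, and the
  -- choice of `g`.
  have h2 : (fun x => mollify n f x - f x) =
      mollify n (f - g) + ((fun x => mollify n g x - g x) - (f - g)) := by
    have h3 : mollify n f = mollify n (f - g) + mollify n g := by
      have := ConvolutionExists.distrib_add (convolutionExists_mollify (hfl.sub hgl) n)
        (convolutionExists_mollify hgl n)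
      rw [sub_add_cancel] at this
      exact this
    ext x
    simp [h3]
    abel
  rw [h2]
  have hm : AEStronglyMeasurable (mollify n (f - g)) volume :=
    (contDiff_mollify (hfl.sub hgl) n).continuous.aestronglyMeasurable
  have hm' : AEStronglyMeasurable (fun x => mollify n g x - g x) volume :=
    ((contDiff_mollify hgl n).continuous.sub hg).aestronglyMeasurable
  have hfgm := (hf.sub hgm).aestronglyMeasurable
  calc _ ≤ eLpNorm (mollify n (f - g)) (ENNReal.ofReal p) volume +
        (eLpNorm (fun x => mollify n g x - g x) (ENNReal.ofReal p) volume +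
          eLpNorm (f - g) (ENNReal.ofReal p) volume) :=
        (eLpNorm_add_le hm (hm'.sub hfgm) hp1).trans (by gcongr; exact eLpNorm_sub_le hm' hfgm hp1)
    _ ≤ ε / 3 + (ε / 3 + ε / 3) := by
        gcongr
        exact (eLpNorm_convolution_normed_le _ hfgm hp).trans hfg
    _ = ε := by rw [← add_assoc, ENNReal.add_thirds]

/-- The gradient of a mollification is the mollification of the weak gradient. -/
theorem HasWeakGradient.gradient_mollify {V : Set (EuclideanSpace ℝ (Fin d))} (hV : IsOpen V)
    {u : EuclideanSpace ℝ (Fin d) → ℝ} {G : EuclideanSpace ℝ (Fin d) → EuclideanSpace ℝ (Fin d)}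
    (h : HasWeakGradient V u G) (hu : IntegrableOn u V) (hG : IntegrableOn G V) {n : ℕ}
    {x : EuclideanSpace ℝ (Fin d)} (hx : Metric.closedBall x (mollifier d n).rOut ⊆ V) :
    gradient (mollify n (V.indicator u)) x = mollify n (V.indicator G) x := by
  have hu' : LocallyIntegrable (V.indicator u) volume :=
    ((integrable_indicator_iff hV.measurableSet).2 hu).locallyIntegrable
  have hG' : LocallyIntegrable (V.indicator G) volume :=
    ((integrable_indicator_iff hV.measurableSet).2 hG).locallyIntegrable
  set ρ := (mollifier d n).normed volume with hρ
  have hρs : ContDiff ℝ ∞ ρ := (mollifier d n).contDiff_normed (n := ⊤)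
  have hρc : HasCompactSupport ρ := (mollifier d n).hasCompactSupport_normed
  -- The reflected kernel is supported in `V`, so it is admissible in the weak gradient identity.
  -- Its derivative in `t` brings a minus sign that cancels the one in that identity.
  set ψ : EuclideanSpace ℝ (Fin d) → ℝ := fun t => ρ (x - t) with hψ
  have hψt : IsTestFunction V ψ := by
    have h1 : tsupport ψ ⊆ Metric.closedBall x (mollifier d n).rOut := by
      refine closure_minimal (fun t ht => ?_) Metric.isClosed_closedBall
      have h2 : x - t ∈ Function.support ρ := ht
      rw [hρ, ContDiffBump.support_normed_eq, mem_ball_zero_iff] at h2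
      rw [Metric.mem_closedBall', dist_eq_norm]
      exact h2.le
    exact ⟨hρs.comp (by fun_prop), (isCompact_closedBall x _).of_isClosed_subset
      (isClosed_tsupport _) h1, h1.trans hx⟩
  have hψd : ∀ i t, partialDeriv i ψ t = -fderiv ℝ ρ (x - t) (EuclideanSpace.single i 1) := by
    intro i t
    have h1 : HasFDerivAt ρ (fderiv ℝ ρ (x - t)) (x - t) :=
      (hρs.contDiffAt.differentiableAt (by simp)).hasFDerivAt
    have h2 : HasFDerivAt ψ _ t := h1.comp t ((hasFDerivAt_id t).const_sub x)
    rw [partialDeriv, h2.fderiv]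
    simp
  ext i
  rw [gradient_apply, partialDeriv]
  have hfl : mollify n (V.indicator u) =
      V.indicator u ⋆[(ContinuousLinearMap.lsmul ℝ ℝ).flip, volume] ρ :=
    (convolution_flip _).symm
  have hD := hρc.hasFDerivAt_convolution_right ((ContinuousLinearMap.lsmul ℝ ℝ).flip) hu'
    (hρs.of_le (by simp)) x
  rw [hfl, hD.fderiv, convolution_precompR_apply _ hu' (hρc.fderiv ℝ)
    (hρs.continuous_fderiv (by simp))]
  have h1 : (V.indicator u ⋆[(ContinuousLinearMap.lsmul ℝ ℝ).flip, volume]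
      fun a => fderiv ℝ ρ a (EuclideanSpace.single i 1)) x =
      -∫ t in V, u t * partialDeriv i ψ t := by
    rw [← integral_neg, ← integral_indicator hV.measurableSet, convolution_def]
    refine integral_congr_ae (ae_of_all _ fun t => ?_)
    by_cases ht : t ∈ V <;> simp [ht, hψd, mul_comm]
  have hflG : mollify n (V.indicator G) =
      V.indicator G ⋆[(ContinuousLinearMap.lsmul ℝ ℝ).flip, volume] ρ :=
    (convolution_flip _).symm
  have hint : Integrable fun t => ψ t • V.indicator G t := by
    have := hρc.convolutionExists_right ((ContinuousLinearMap.lsmul ℝ ℝ).flip) hG' hρs.continuous x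
    simpa [ConvolutionExistsAt] using this
  have h2 : ∫ t, (ψ t • V.indicator G t) i = (∫ t, ψ t • V.indicator G t) i :=
    (EuclideanSpace.proj (𝕜 := ℝ) i : EuclideanSpace ℝ (Fin d) →L[ℝ] ℝ).integral_comp_comm hint
  rw [h1, h.2.2 ψ hψt i, neg_neg, hflG, convolution_def]
  rw [← integral_indicator hV.measurableSet]
  refine Eq.trans ?_ h2
  refine integral_congr_ae (ae_of_all _ fun t => ?_)
  by_cases ht : t ∈ V <;> simp [ht, mul_comm]

/-! ### Continuous representatives of `u - g` and `g`. -/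

/-- Functions in `W₀^{1,p}(Ω)`, `p > d`, have a continuous representative that vanishes outside
`Ω`. -/
theorem MemSobolevZero.exists_continuous {Ω : Set (EuclideanSpace ℝ (Fin d))}
    (hΩb : Bornology.IsBounded Ω) (hd : 2 ≤ d) {p : ℝ} (hp : (d : ℝ) < p)
    {w : EuclideanSpace ℝ (Fin d) → ℝ} (hw : MemSobolevZero Ω (ENNReal.ofReal p) w) :
    ∃ w' : EuclideanSpace ℝ (Fin d) → ℝ, Continuous w' ∧ w' =ᵐ[volume.restrict Ω] w ∧
      ∀ x ∉ Ω, w' x = 0 := by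
  obtain ⟨hwp, G, -, hG, happ⟩ := hw
  have hd' : (2 : ℝ) ≤ d := by exact_mod_cast hd
  have hp1 : 1 ≤ ENNReal.ofReal p := by simpa using by linarith
  obtain ⟨C, hC, hφC⟩ := exists_enorm_le_mul_eLpNorm_gradient hΩb hd hp
  -- For `n = 0` the tolerance is `⊤`, which is harmless since only large `n` matter.
  choose φ hφ hφw hφG using fun n : ℕ => happ ((n : ℝ≥0∞)⁻¹) (by simp)
  set b : ℕ → ℝ≥0∞ := fun n => C * ((n : ℝ≥0∞)⁻¹ + (n : ℝ≥0∞)⁻¹) with hb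
  have hb0 : Tendsto b atTop (𝓝 0) := by
    have h := ENNReal.tendsto_inv_nat_nhds_zero
    simpa using ENNReal.Tendsto.const_mul (h.add h) (Or.inr hC)
  have hbd : ∀ x n m N, N ≤ n → N ≤ m → edist (φ n x) (φ m x) ≤ b N := by
    intro x n m N hn hm
    rw [edist_eq_enorm_sub]
    refine (hφC _ ((hφ n).sub (hφ m)) x).trans ?_
    rw [hb]
    dsimp only
    gcongr
    have h1 : gradient (fun y => φ n y - φ m y) =
        (fun y => gradient (φ n) y - G y) - fun y => gradient (φ m) y - G y := by
      ext1 y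
      have h2 : fderiv ℝ (fun y => φ n y - φ m y) y = fderiv ℝ (φ n) y - fderiv ℝ (φ m) y :=
        fderiv_fun_sub ((hφ n).1.contDiffAt.differentiableAt (by simp))
          ((hφ m).1.contDiffAt.differentiableAt (by simp))
      simp [gradient, h2]
    have hm : ∀ k, AEStronglyMeasurable (fun y => gradient (φ k) y - G y) (volume.restrict Ω) :=
      fun k => (hφ k).continuous_gradient.aestronglyMeasurable.sub hG.aestronglyMeasurable
    rw [h1]
    refine (eLpNorm_sub_le (hm n) (hm m) hp1).trans ?_
    gcongr
    · exact (hφG n).le.trans (by gcongr)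
    · exact (hφG _).le.trans (by gcongr)
  have hlim : ∀ x, ∃ y, Tendsto (fun n => φ n x) atTop (𝓝 y) := fun x =>
    cauchySeq_tendsto_of_complete (EMetric.cauchySeq_iff_le_tendsto_0.2 ⟨b, hbd x, hb0⟩)
  choose w' hw' using hlim
  have hunif : TendstoUniformly φ w' atTop := by
    rw [EMetric.tendstoUniformly_iff]
    intro ε hε
    filter_upwards [hb0.eventually_lt_const hε] with n hn x
    refine lt_of_le_of_lt ?_ hn
    refine le_of_tendsto ((hw' x).edist tendsto_const_nhds) ?_
    filter_upwards [eventually_ge_atTop n] with m hm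
    exact hbd x m n n hm le_rfl
  refine ⟨w', hunif.continuous (Frequently.of_forall fun n => (hφ n).1.continuous), ?_,
    fun x hx => ?_⟩
  · have h1 : Tendsto (fun n => eLpNorm (φ n - w) (ENNReal.ofReal p) (volume.restrict Ω)) atTop
        (𝓝 0) :=
      tendsto_of_tendsto_of_tendsto_of_le_of_le tendsto_const_nhds
        ENNReal.tendsto_inv_nat_nhds_zero (fun _ => zero_le) fun n => (hφw n).le
    -- An almost everywhere convergent subsequence identifies the uniform limit with `w`.
    obtain ⟨ns, hns, hae⟩ := (tendstoInMeasure_of_tendsto_eLpNorm (by positivity)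
      (fun n => (hφ n).1.continuous.aestronglyMeasurable) hwp.aestronglyMeasurable
      h1).exists_seq_tendsto_ae
    filter_upwards [hae] with x hx
    exact tendsto_nhds_unique ((hw' x).comp hns.tendsto_atTop) hx
  · refine tendsto_nhds_unique (hw' x) ?_
    simp [fun n => (hφ n).eq_zero hx]

theorem norm_mollify_le {F : Type*} [NormedAddCommGroup F] [NormedSpace ℝ F]
    {f : EuclideanSpace ℝ (Fin d) → F} {L : ℝ} (hf : ∀ᵐ x, ‖f x‖ ≤ L) (n : ℕ)
    (x : EuclideanSpace ℝ (Fin d)) : ‖mollify n f x‖ ≤ L := by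
  have h1 : ∀ᵐ t, ‖f (x - t)‖ ≤ L :=
    (quasiMeasurePreserving_sub_left volume x).ae hf
  have h2 : ‖mollify n f x‖ ≤ ∫ t, (mollifier d n).normed volume t * L := by
    refine norm_integral_le_of_norm_le ((mollifier d n).integrable_normed.mul_const L) ?_
    filter_upwards [h1] with t ht
    rw [ContinuousLinearMap.lsmul_apply, norm_smul,
      Real.norm_of_nonneg ((mollifier d n).nonneg_normed t)]
    exact mul_le_mul_of_nonneg_left ht ((mollifier d n).nonneg_normed t)
  rwa [integral_mul_const, ContDiffBump.integral_normed, one_mul] at h2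

/-- Functions in `W^{1,∞}(Ω)` have a continuous representative. -/
theorem MemSobolev.exists_continuousOn {Ω : Set (EuclideanSpace ℝ (Fin d))} (hΩ : IsOpen Ω)
    (hΩb : Bornology.IsBounded Ω) {g : EuclideanSpace ℝ (Fin d) → ℝ} (hg : MemSobolev Ω ⊤ g) :
    ∃ g' : EuclideanSpace ℝ (Fin d) → ℝ, g' =ᵐ[volume.restrict Ω] g ∧ ContinuousOn g' Ω := by
  obtain ⟨hgm, G, hG, hGm⟩ := hg
  have : IsFiniteMeasure (volume.restrict Ω) :=
    ⟨by rw [Measure.restrict_apply_univ]; exact hΩb.measure_lt_top⟩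
  have hgi : IntegrableOn g Ω := hgm.integrable le_top
  have hGi : IntegrableOn G Ω := hGm.integrable le_top
  set L : NNReal := (eLpNorm G ⊤ (volume.restrict Ω)).toNNReal with hL
  have hGL : ∀ᵐ x, ‖Ω.indicator G x‖ ≤ L := by
    have h1 : ∀ᵐ x ∂volume.restrict Ω, ‖G x‖ₑ ≤ L := by
      rw [hL, ENNReal.coe_toNNReal hGm.2.ne, eLpNorm_exponent_top]
      exact ae_le_eLpNormEssSup
    rw [ae_restrict_iff' hΩ.measurableSet] at h1
    filter_upwards [h1] with x hx
    by_cases hxΩ : x ∈ Ω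
    · rw [indicator_of_mem hxΩ]
      exact enorm_le_coe.1 (hx hxΩ)
    · simp [hxΩ]
  -- On this set of full measure in `Ω`, hence dense in `Ω`, Lipschitz bounds for the mollifications
  -- pass to `g` itself.
  set A : Set (EuclideanSpace ℝ (Fin d)) :=
    {x | x ∈ Ω ∧ Tendsto (fun n => mollify n (Ω.indicator g) x) atTop (𝓝 (g x))} with hA
  have hAae : ∀ᵐ x, x ∈ Ω → x ∈ A := by
    filter_upwards [ae_tendsto_mollify
      ((integrable_indicator_iff hΩ.measurableSet).2 hgi).locallyIntegrable] with x hx hxΩ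
    rw [indicator_of_mem hxΩ] at hx
    exact ⟨hxΩ, hx⟩
  have hcl : Ω ⊆ closure A := by
    intro x hx
    rw [mem_closure_iff]
    intro o ho hxo
    by_contra hne
    have h0 : volume (o ∩ Ω) = 0 := by
      refine measure_mono_null (fun y hy => ?_) hAae
      intro h
      exact hne ⟨y, hy.1, h hy.2⟩
    exact ((ho.inter hΩ).measure_pos volume ⟨x, hxo, hx⟩).ne' h0
  have hloc : ∀ x ∈ Ω, ∃ f : EuclideanSpace ℝ (Fin d) → ℝ, Continuous f ∧
      ∀ᶠ y in 𝓝 x, y ∈ A → g y = f y := by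
    intro x hx
    obtain ⟨r, hr, hrΩ⟩ := Metric.isOpen_iff.1 hΩ x hx
    -- The mean value inequality needs a convex set, so the bound is local. Half the radius leaves
    -- room for the mollifier to stay inside `Ω`.
    have hLip : LipschitzOnWith L g (A ∩ Metric.ball x (r / 2)) := by
      refine LipschitzOnWith.of_dist_le_mul fun y hy z hz => ?_
      refine le_of_tendsto (hy.1.2.dist hz.1.2) ?_
      filter_upwards [(tendsto_mollifier_rOut (d := d)).eventually_lt_const (half_pos hr)] with n hn
      rw [dist_eq_norm, dist_eq_norm]
      have hc := contDiff_mollify (d := d)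
        ((integrable_indicator_iff hΩ.measurableSet).2 hgi).locallyIntegrable n
      refine (convex_ball x (r / 2)).norm_image_sub_le_of_norm_fderiv_le
        (fun w _ => hc.contDiffAt.differentiableAt (by simp)) (fun w hw => ?_) hz.2 hy.2
      rw [← norm_gradient, hG.gradient_mollify hΩ hgi hGi]
      · exact norm_mollify_le hGL n w
      · refine subset_trans (fun v hv => ?_) hrΩ
        rw [Metric.mem_ball] at hw ⊢
        rw [Metric.mem_closedBall] at hv
        linarith [dist_triangle v w x]
    obtain ⟨f, hf, hfg⟩ := hLip.extend_real
    refine ⟨f, hf.continuous, ?_⟩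
    filter_upwards [Metric.ball_mem_nhds x (half_pos hr)] with y hy hyA
    exact hfg ⟨hyA, hy⟩
  have hlim : ∀ x ∈ Ω, ∃ y, Tendsto g (𝓝[A] x) (𝓝 y) := by
    intro x hx
    obtain ⟨f, hf, hfg⟩ := hloc x hx
    refine ⟨f x, (hf.tendsto x |>.mono_left nhdsWithin_le_nhds).congr' ?_⟩
    rw [EventuallyEq, eventually_nhdsWithin_iff]
    filter_upwards [hfg] with y hy hyA
    exact (hy hyA).symm
  refine ⟨extendFrom A g, ?_, continuousOn_extendFrom hcl hlim⟩
  rw [EventuallyEq, ae_restrict_iff' hΩ.measurableSet]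
  filter_upwards [hAae] with x hx hxΩ
  obtain ⟨f, hf, hfg⟩ := hloc x hxΩ
  refine extendFrom_eq (hcl hxΩ) ?_
  rw [hfg.self_of_nhds (hx hxΩ)]
  refine (hf.tendsto x |>.mono_left nhdsWithin_le_nhds).congr' ?_
  rw [EventuallyEq, eventually_nhdsWithin_iff]
  filter_upwards [hfg] with y hy hyA
  exact (hy hyA).symm

/-! ### Monotonicity and duality for the flux. -/

/-- The vector field `ξ ↦ |ξ|^{p-2} ξ` of the `p`-Laplacian. -/
def flux (p : ℝ) (ξ : EuclideanSpace ℝ (Fin d)) : EuclideanSpace ℝ (Fin d) := ‖ξ‖ ^ (p - 2) • ξ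

theorem continuous_flux {p : ℝ} (hp : 2 < p) : Continuous (flux (d := d) p) :=
  (continuous_norm.rpow_const fun _ => Or.inr (by linarith)).smul continuous_id

theorem flux_neg (p : ℝ) (ξ : EuclideanSpace ℝ (Fin d)) : flux p (-ξ) = -flux p ξ := by
  simp [flux]

theorem norm_flux {p : ℝ} (hp : 2 < p) (ξ : EuclideanSpace ℝ (Fin d)) :
    ‖flux p ξ‖ = ‖ξ‖ ^ (p - 1) := by
  rw [flux, norm_smul, Real.norm_of_nonneg (by positivity)]
  nth_rewrite 2 [← Real.rpow_one ‖ξ‖]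
  rw [← Real.rpow_add_of_nonneg (norm_nonneg _) (by linarith) (by norm_num)]
  congr 1
  ring

/-- Cauchy–Schwarz on the cross term reduces the claim to `(|a|^{p-1} - |b|^{p-1}) (|a| - |b|) ≥ 0`,
which is the monotonicity of a power. -/
theorem inner_flux_sub_nonneg {p : ℝ} (hp : 2 < p) (a b : EuclideanSpace ℝ (Fin d)) :
    0 ≤ inner ℝ (flux p a - flux p b) (a - b) := by
  have h1 : inner ℝ (flux p a - flux p b) (a - b) =
      ‖a‖ ^ (p - 2) * ‖a‖ ^ 2 + ‖b‖ ^ (p - 2) * ‖b‖ ^ 2 -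
        (‖a‖ ^ (p - 2) + ‖b‖ ^ (p - 2)) * inner ℝ a b := by
    rw [flux, flux, inner_sub_left, inner_sub_right, inner_sub_right, real_inner_smul_left,
      real_inner_smul_left, real_inner_smul_left, real_inner_smul_left,
      real_inner_self_eq_norm_sq, real_inner_self_eq_norm_sq, real_inner_comm a b]
    ring
  have h2 := real_inner_le_norm a b
  have ha : 0 ≤ ‖a‖ ^ (p - 2) := by positivity
  have hb : 0 ≤ ‖b‖ ^ (p - 2) := by positivity
  have h3 : 0 ≤ (‖a‖ ^ (p - 2) * ‖a‖ - ‖b‖ ^ (p - 2) * ‖b‖) * (‖a‖ - ‖b‖) := by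
    rcases le_total ‖a‖ ‖b‖ with h | h
    · have := Real.rpow_le_rpow (norm_nonneg a) h (by linarith : 0 ≤ p - 2)
      exact mul_nonneg_of_nonpos_of_nonpos
        (sub_nonpos.2 (mul_le_mul this h (norm_nonneg _) hb)) (sub_nonpos.2 h)
    · have := Real.rpow_le_rpow (norm_nonneg b) h (by linarith : 0 ≤ p - 2)
      exact mul_nonneg (sub_nonneg.2 (mul_le_mul this h (norm_nonneg _) ha)) (sub_nonneg.2 h)
  rw [h1]
  nlinarith [mul_le_mul_of_nonneg_left h2 (add_nonneg ha hb)]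

/-- The flux has size `|ξ|^{p-1}`, so it lands in the dual exponent and pairs with gradients in
`Lᵖ`. -/
theorem memLp_flux {α : Type*} [MeasurableSpace α] {μ : Measure α} {p : ℝ} (hp : 2 < p)
    {f : α → EuclideanSpace ℝ (Fin d)} (hf : MemLp f (ENNReal.ofReal p) μ) :
    MemLp (fun x => flux p (f x)) (ENNReal.ofReal (p / (p - 1))) μ := by
  have h := hf.norm_rpow_div (ENNReal.ofReal (p - 1))
  rw [ENNReal.toReal_ofReal (by linarith), ← ENNReal.ofReal_div_of_pos (by linarith)] at h
  refine h.mono ((continuous_flux hp).comp_aestronglyMeasurable hf.aestronglyMeasurable)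
    (ae_of_all _ fun x => ?_)
  rw [norm_flux hp]
  exact Real.le_norm_self _

theorem holderConjugate_ofReal {p : ℝ} (hp : 2 < p) :
    (ENNReal.ofReal (p / (p - 1))).HolderConjugate (ENNReal.ofReal p) :=
  (Real.HolderConjugate.conjExponent (by linarith : 1 < p)).symm.ennrealOfReal

theorem integrable_inner {α : Type*} [MeasurableSpace α] {μ : Measure α} {p q : ℝ≥0∞}
    [q.HolderConjugate p] {H F : α → EuclideanSpace ℝ (Fin d)} (hH : MemLp H q μ)
    (hF : MemLp F p μ) : Integrable (fun x => inner ℝ (H x) (F x)) μ := by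
  rw [← memLp_one_iff_integrable]
  exact ⟨hH.1.inner hF.1, (eLpNorm_le_eLpNorm_mul_eLpNorm_of_nnnorm (r := 1) hH.1 hF.1
    (fun a b => inner ℝ a b) 1 (ae_of_all _ fun x => by
      rw [one_mul]; exact nnnorm_inner_le_nnnorm _ _)).trans_lt
    (ENNReal.mul_lt_top (ENNReal.mul_lt_top (by simp) hH.2) hF.2)⟩

theorem tendsto_integral_inner {α : Type*} [MeasurableSpace α] {μ : Measure α} {p q : ℝ≥0∞}
    [q.HolderConjugate p] {H F : α → EuclideanSpace ℝ (Fin d)}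
    {Fn : ℕ → α → EuclideanSpace ℝ (Fin d)} (hH : MemLp H q μ) (hF : MemLp F p μ)
    (hFn : ∀ᶠ n in atTop, MemLp (Fn n) p μ)
    (hlim : Tendsto (fun n => eLpNorm (fun x => Fn n x - F x) p μ) atTop (𝓝 0)) :
    Tendsto (fun n => ∫ x, inner ℝ (H x) (Fn n x) ∂μ) atTop (𝓝 (∫ x, inner ℝ (H x) (F x) ∂μ)) := by
  refine tendsto_integral_of_L1' _ (integrable_inner hH hF).aestronglyMeasurable
    (hFn.mono fun n hn => integrable_inner hH hn) ?_
  have h1 : Tendsto (fun n => eLpNorm H q μ * eLpNorm (fun x => Fn n x - F x) p μ) atTop (𝓝 0) := by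
    simpa using ENNReal.Tendsto.const_mul hlim (Or.inr hH.2.ne)
  refine tendsto_of_tendsto_of_tendsto_of_le_of_le' tendsto_const_nhds h1
    (Eventually.of_forall fun _ => zero_le) ?_
  filter_upwards [hFn] with n hn
  have h2 := eLpNorm_le_eLpNorm_mul_eLpNorm_of_nnnorm (p := q) (q := p) (r := 1) hH.1
    (hn.1.sub hF.1) (fun a b => inner ℝ a b) 1 (ae_of_all _ fun x => by
      rw [one_mul]; exact nnnorm_inner_le_nnnorm _ _)
  simp only [Pi.sub_apply, inner_sub_right, ENNReal.coe_one, one_mul] at h2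
  exact h2

/-- From `aₙGₙ - aG = aₙ(Gₙ - G) + (aₙ - a)G`: the first term uses the bound on `aₙ`, the second
their uniform convergence. It serves `a = η'(w)`, with `G` the weak gradient of `w`. -/
theorem tendsto_eLpNorm_smul_sub {α F : Type*} [MeasurableSpace α] {μ : Measure α}
    [NormedAddCommGroup F] [NormedSpace ℝ F] {p : ℝ≥0∞} (hp : 1 ≤ p) {s : Set α}
    (hs : ∀ᵐ x ∂μ, x ∈ s) {a : α → ℝ} {an : ℕ → α → ℝ} {G : α → F} {Gn : ℕ → α → F} {M : ℝ}
    (ha : AEStronglyMeasurable a μ) (han : ∀ n, AEStronglyMeasurable (an n) μ)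
    (hM : ∀ n x, ‖an n x‖ ≤ M) (hlim : TendstoUniformlyOn an a atTop s) (hG : MemLp G p μ)
    (hGn : ∀ n, AEStronglyMeasurable (Gn n) μ)
    (hGlim : Tendsto (fun n => eLpNorm (fun x => Gn n x - G x) p μ) atTop (𝓝 0)) :
    Tendsto (fun n => eLpNorm (fun x => an n x • Gn n x - a x • G x) p μ) atTop (𝓝 0) := by
  rw [ENNReal.tendsto_nhds_zero]
  intro ε hε
  have hε2 : 0 < ε / 2 := by simpa using hε.ne'
  have h1 : Tendsto (fun n => ENNReal.ofReal M * eLpNorm (fun x => Gn n x - G x) p μ) atTop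
      (𝓝 0) := by
    simpa using ENNReal.Tendsto.const_mul hGlim (Or.inr (ENNReal.ofReal_ne_top (r := M)))
  obtain ⟨δ, hδ, hδε⟩ : ∃ δ : ℝ, 0 < δ ∧ ENNReal.ofReal δ * eLpNorm G p μ ≤ ε / 2 := by
    have h1 : Tendsto (fun δ : ℝ => ENNReal.ofReal δ * eLpNorm G p μ)
        (𝓝[>] 0) (𝓝 (ENNReal.ofReal 0 * eLpNorm G p μ)) :=
      ENNReal.Tendsto.mul_const ((ENNReal.continuous_ofReal.tendsto 0).mono_left
        nhdsWithin_le_nhds) (Or.inr hG.2.ne)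
    rw [ENNReal.ofReal_zero, zero_mul] at h1
    obtain ⟨δ, h2, h3⟩ := ((h1.eventually_le_const hε2).and self_mem_nhdsWithin).exists
    exact ⟨δ, h3, h2⟩
  filter_upwards [h1.eventually_le_const hε2, Metric.tendstoUniformlyOn_iff.1 hlim δ hδ]
    with n hn1 hn2
  have h2 : (fun x => an n x • Gn n x - a x • G x) =
      (fun x => an n x • (Gn n x - G x)) + fun x => (an n x - a x) • G x := by
    ext1 x
    simp [smul_sub, sub_smul]
  rw [h2]
  refine (eLpNorm_add_le ((han n).smul ((hGn n).sub hG.1)) (((han n).sub ha).smul hG.1) hp).trans ?_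
  rw [← ENNReal.add_halves ε]
  gcongr
  · refine (eLpNorm_le_mul_eLpNorm_of_ae_le_mul (ae_of_all _ fun x => ?_) p).trans hn1
    change ‖an n x • (Gn n x - G x)‖ ≤ _
    rw [norm_smul]
    exact mul_le_mul_of_nonneg_right (hM n x) (norm_nonneg _)
  · refine (eLpNorm_le_mul_eLpNorm_of_ae_le_mul ?_ p).trans hδε
    filter_upwards [hs] with x hx
    change ‖(an n x - a x) • G x‖ ≤ _
    rw [norm_smul, ← dist_eq_norm, dist_comm]
    exact mul_le_mul_of_nonneg_right (hn2 x hx).le (norm_nonneg _)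

/-! ### Smooth truncation `η(w)` inside a ball. -/

theorem continuous_deriv_smoothTransition : Continuous (deriv Real.smoothTransition) :=
  (Real.smoothTransition.contDiff (n := 1)).continuous_deriv le_rfl

theorem deriv_smoothTransition_nonneg (x : ℝ) : 0 ≤ deriv Real.smoothTransition x :=
  Real.smoothTransition.monotone.deriv_nonneg

/-- Compact support makes `η'` bounded and uniformly continuous, so that `η'(wₙ)` inherits uniform
convergence from `wₙ`. -/
theorem hasCompactSupport_deriv_smoothTransition :
    HasCompactSupport (deriv Real.smoothTransition) := by
  refine HasCompactSupport.intro (isCompact_Icc (a := (0 : ℝ)) (b := 1)) fun x hx => ?_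
  rw [mem_Icc, not_and_or, not_le, not_le] at hx
  rcases hx with hx | hx
  · have : Real.smoothTransition =ᶠ[𝓝 x] fun _ => 0 := by
      filter_upwards [Iio_mem_nhds hx] with y hy using
        Real.smoothTransition.zero_of_nonpos (le_of_lt hy)
    rw [this.deriv_eq, deriv_const]
  · have : Real.smoothTransition =ᶠ[𝓝 x] fun _ => 1 := by
      filter_upwards [Ioi_mem_nhds hx] with y hy using
        Real.smoothTransition.one_of_one_le (le_of_lt hy)
    rw [this.deriv_eq, deriv_const]

/-- If `w` is negative on a sphere, then the part of `η(w)` inside the ball is a test function. -/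
theorem isTestFunction_indicator_smoothTransition {w : EuclideanSpace ℝ (Fin d) → ℝ}
    (hw : ContDiff ℝ ∞ w) {x₀ : EuclideanSpace ℝ (Fin d)} {r : ℝ}
    (hneg : ∀ x ∈ Metric.sphere x₀ r, w x < 0) :
    IsTestFunction (Metric.ball x₀ r)
      ((Metric.ball x₀ r).indicator fun x => Real.smoothTransition (w x)) := by
  set v := (Metric.ball x₀ r).indicator fun x => Real.smoothTransition (w x) with hv
  have hc : ContDiff ℝ ∞ fun x => Real.smoothTransition (w x) :=
    (Real.smoothTransition.contDiff (n := ⊤)).comp hw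
  -- The only delicate points lie on the sphere: there `w < 0` persists nearby and `η` vanishes on
  -- negative numbers, so cutting off creates no jump.
  have hout : ∀ x ∉ Metric.ball x₀ r, v =ᶠ[𝓝 x] fun _ => 0 := by
    intro x hx
    rcases (not_lt.1 (fun h => hx (Metric.mem_ball.2 h))).eq_or_lt with hx | hx
    · filter_upwards [hw.continuous.continuousAt.eventually_lt_const (hneg x hx.symm)] with y hy
      rw [hv, indicator_apply_eq_zero]
      exact fun _ => Real.smoothTransition.zero_of_nonpos hy.le
    · filter_upwards [Metric.isClosed_closedBall.isOpen_compl.mem_nhds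
        (fun h => (not_le.2 hx) (Metric.mem_closedBall.1 h))] with y hy
      exact indicator_of_notMem (fun h => hy (Metric.ball_subset_closedBall h)) _
  have hs : tsupport v ⊆ Metric.ball x₀ r := fun x hx => by
    by_contra h
    exact notMem_tsupport_iff_eventuallyEq.2 (hout x h) hx
  refine ⟨contDiff_iff_contDiffAt.2 fun x => ?_, (isCompact_closedBall x₀ r).of_isClosed_subset
      (isClosed_tsupport _) (hs.trans Metric.ball_subset_closedBall), hs⟩
  by_cases hx : x ∈ Metric.ball x₀ r
  · refine hc.contDiffAt.congr_of_eventuallyEq ?_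
    filter_upwards [Metric.isOpen_ball.mem_nhds hx] with y hy
    rw [hv, indicator_of_mem hy]
  · exact (contDiffAt_const (c := (0 : ℝ))).congr_of_eventuallyEq (hout x hx)

theorem gradient_indicator_smoothTransition {w : EuclideanSpace ℝ (Fin d) → ℝ}
    (hw : ContDiff ℝ ∞ w) {x₀ x : EuclideanSpace ℝ (Fin d)} {r : ℝ} (hx : x ∈ Metric.ball x₀ r) :
    gradient ((Metric.ball x₀ r).indicator fun x => Real.smoothTransition (w x)) x =
      deriv Real.smoothTransition (w x) • gradient w x := by
  have h1 : ((Metric.ball x₀ r).indicator fun x => Real.smoothTransition (w x)) =ᶠ[𝓝 x]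
      fun x => Real.smoothTransition (w x) := by
    filter_upwards [Metric.isOpen_ball.mem_nhds hx] with y hy
    rw [indicator_of_mem hy]
  have h2 : HasFDerivAt w (fderiv ℝ w x) x :=
    (hw.contDiffAt.differentiableAt (by simp)).hasFDerivAt
  have h3 : HasDerivAt Real.smoothTransition (deriv Real.smoothTransition (w x)) (w x) :=
    ((Real.smoothTransition.contDiff (n := 1)).contDiffAt.differentiableAt (by simp)).hasDerivAt
  have h4 : HasFDerivAt (fun x => Real.smoothTransition (w x)) _ x := h3.comp_hasFDerivAt x h2
  rw [gradient, h1.fderiv_eq, h4.fderiv]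
  simp [gradient]

theorem IsTestFunction.partialDeriv_eq_zero {Ω : Set (EuclideanSpace ℝ (Fin d))}
    {φ : EuclideanSpace ℝ (Fin d) → ℝ} (hφ : IsTestFunction Ω φ) {x : EuclideanSpace ℝ (Fin d)}
    (hx : x ∉ Ω) (i : Fin d) : partialDeriv i φ x = 0 := by
  rw [partialDeriv, hφ.fderiv_eq_zero hx]
  rfl

/-! ### Localisation to balls and the divergence theorem. -/

theorem setIntegral_congr_set_of_eq_zero {f : EuclideanSpace ℝ (Fin d) → ℝ}
    {U V : Set (EuclideanSpace ℝ (Fin d))} (hUV : U ⊆ V) (hf : ∀ x ∉ U, f x = 0) :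
    ∫ x in V, f x = ∫ x in U, f x := by
  rw [setIntegral_eq_integral_of_forall_compl_eq_zero hf,
    setIntegral_eq_integral_of_forall_compl_eq_zero fun x hx => hf x fun h => hx (hUV h)]

theorem HasWeakGradient.mono {Ω V : Set (EuclideanSpace ℝ (Fin d))}
    {u : EuclideanSpace ℝ (Fin d) → ℝ}
    {G : EuclideanSpace ℝ (Fin d) → EuclideanSpace ℝ (Fin d)} (h : HasWeakGradient Ω u G)
    (hV : V ⊆ Ω) : HasWeakGradient V u G := by
  refine ⟨h.1.mono_set hV, h.2.1.mono_set hV, fun φ hφ i => ?_⟩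
  rw [← setIntegral_congr_set_of_eq_zero hV fun x hx => by
      rw [hφ.partialDeriv_eq_zero hx, mul_zero],
    ← setIntegral_congr_set_of_eq_zero hV fun x hx => by rw [hφ.eq_zero hx, mul_zero]]
  exact h.2.2 φ (hφ.mono hV) i

theorem HasWeakGradient.sub {V : Set (EuclideanSpace ℝ (Fin d))}
    {u v : EuclideanSpace ℝ (Fin d) → ℝ}
    {G H : EuclideanSpace ℝ (Fin d) → EuclideanSpace ℝ (Fin d)} (h : HasWeakGradient V u G)
    (h' : HasWeakGradient V v H) (hu : IntegrableOn u V) (hv : IntegrableOn v V)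
    (hG : IntegrableOn G V) (hH : IntegrableOn H V) :
    HasWeakGradient V (fun x => u x - v x) (fun x => G x - H x) := by
  refine ⟨h.1.sub h'.1, h.2.1.sub h'.2.1, fun φ hφ i => ?_⟩
  have hφ' : Continuous (partialDeriv i φ) :=
    (hφ.1.continuous_fderiv (by simp)).clm_apply continuous_const
  have h1 : MemLp φ ⊤ (volume.restrict V) :=
    (hφ.1.continuous.memLp_of_hasCompactSupport hφ.2.1).restrict V
  have h2 : MemLp (partialDeriv i φ) ⊤ (volume.restrict V) :=
    (hφ'.memLp_of_hasCompactSupport ((hφ.2.1.fderiv ℝ).comp_left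
      (g := fun L : EuclideanSpace ℝ (Fin d) →L[ℝ] ℝ => L (EuclideanSpace.single i 1))
      rfl)).restrict V
  have hGi : Integrable (fun x => G x i) (volume.restrict V) :=
    (EuclideanSpace.proj (𝕜 := ℝ) i : EuclideanSpace ℝ (Fin d) →L[ℝ] ℝ).integrable_comp hG
  have hHi : Integrable (fun x => H x i) (volume.restrict V) :=
    (EuclideanSpace.proj (𝕜 := ℝ) i : EuclideanSpace ℝ (Fin d) →L[ℝ] ℝ).integrable_comp hH
  have e1 := integral_sub (hu.mul_of_top_left h2) (hv.mul_of_top_left h2)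
  have e2 := integral_sub (hGi.mul_of_top_left h1) (hHi.mul_of_top_left h1)
  simp only [Pi.mul_apply] at e1 e2
  simp only [sub_mul, PiLp.sub_apply]
  rw [e1, e2, h.2.2 φ hφ i, h'.2.2 φ hφ i]
  ring

theorem isFiniteMeasure_restrict_ball (x : EuclideanSpace ℝ (Fin d)) (r : ℝ) :
    IsFiniteMeasure (volume.restrict (Metric.ball x r)) :=
  ⟨by rw [Measure.restrict_apply_univ]; exact Metric.isBounded_ball.measure_lt_top⟩

theorem memLp_ball_of_continuousOn {F : Type*} [NormedAddCommGroup F]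
    {f : EuclideanSpace ℝ (Fin d) → F} {x : EuclideanSpace ℝ (Fin d)} {r : ℝ}
    (hf : ContinuousOn f (Metric.closedBall x r)) (q : ℝ≥0∞) :
    MemLp f q (volume.restrict (Metric.ball x r)) := by
  obtain ⟨C, hC⟩ := (isCompact_closedBall x r).exists_bound_of_continuousOn hf
  have := isFiniteMeasure_restrict_ball x r
  refine MemLp.of_bound ((hf.mono Metric.ball_subset_closedBall).aestronglyMeasurable
    measurableSet_ball) C ?_
  filter_upwards [ae_restrict_mem measurableSet_ball] with y hy
  exact hC y (Metric.ball_subset_closedBall hy)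

/-- The divergence theorem for a `C¹` vector field against a test function. -/
theorem integral_inner_gradient {U : Set (EuclideanSpace ℝ (Fin d))} (hU : IsOpen U)
    {X : EuclideanSpace ℝ (Fin d) → EuclideanSpace ℝ (Fin d)} (hX : ContDiffOn ℝ 1 X U)
    {v : EuclideanSpace ℝ (Fin d) → ℝ} (hv : IsTestFunction U v) :
    ∫ x in U, inner ℝ (X x) (gradient v x) =
      -∫ x in U, (∑ i, partialDeriv i (fun y => X y i) x) * v x := by
  have hXi : ∀ i, ContDiffOn ℝ 1 (fun y => X y i) U := fun i =>
    (EuclideanSpace.proj (𝕜 := ℝ) i : EuclideanSpace ℝ (Fin d) →L[ℝ] ℝ).contDiff.comp_contDiffOn hX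
  have hv' : ∀ i, Continuous (partialDeriv i v) := fun i =>
    (hv.1.continuous_fderiv (by simp)).clm_apply continuous_const
  have hXi' : ∀ i, ContinuousOn (partialDeriv i fun y => X y i) U := fun i =>
    ((hXi i).continuousOn_fderiv_of_isOpen hU le_rfl).clm_apply continuousOn_const
  have ht : IsTestFunction (tsupport v) v := ⟨hv.1, hv.2.1, subset_rfl⟩
  have h1 : ∀ x, inner ℝ (X x) (gradient v x) = ∑ i, X x i * partialDeriv i v x := by
    intro x
    rw [PiLp.inner_apply]
    refine Finset.sum_congr rfl fun i _ => ?_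
    rw [gradient_apply]
    simp [mul_comm]
  simp_rw [h1, Finset.sum_mul]
  rw [integral_finsetSum, integral_finsetSum, ← Finset.sum_neg_distrib]
  · exact Finset.sum_congr rfl fun i _ => integral_mul_partialDeriv hU (hXi i) hv i
  · intro i _
    refine (integrable_of_continuousOn_of_support_subset hv.2.1
      (((hXi' i).mono hv.2.2).mul hv.1.continuous.continuousOn) fun x hx => ?_).integrableOn
    contrapose! hx
    rw [Function.notMem_support]
    exact mul_eq_zero_of_right _ (ht.eq_zero hx)
  · intro i _
    refine (integrable_of_continuousOn_of_support_subset hv.2.1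
      (((hXi i).continuousOn.mono hv.2.2).mul (hv' i).continuousOn) fun x hx => ?_).integrableOn
    contrapose! hx
    rw [Function.notMem_support]
    exact mul_eq_zero_of_right _ (ht.partialDeriv_eq_zero hx i)

theorem contDiffOn_gradient {Ω : Set (EuclideanSpace ℝ (Fin d))} (hΩ : IsOpen Ω)
    {ψ : EuclideanSpace ℝ (Fin d) → ℝ} (hψ : ContDiffOn ℝ 2 ψ Ω) :
    ContDiffOn ℝ 1 (gradient ψ) Ω :=
  ((InnerProductSpace.toDual ℝ (EuclideanSpace ℝ (Fin d))).symm.contDiff).comp_contDiffOn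
    (hψ.fderiv_of_isOpen hΩ (by norm_num))

theorem contDiffOn_flux {U : Set (EuclideanSpace ℝ (Fin d))} (p : ℝ)
    {Y : EuclideanSpace ℝ (Fin d) → EuclideanSpace ℝ (Fin d)} (hY : ContDiffOn ℝ 1 Y U)
    (h0 : ∀ x ∈ U, Y x ≠ 0) : ContDiffOn ℝ 1 (fun y => flux p (Y y)) U :=
  ((hY.norm ℝ h0).rpow_const_of_ne fun x hx => norm_ne_zero_iff.2 (h0 x hx)).smul hY

/-! ### Comparison at a touching point. -/

/-- Test functions approximating `η(w)`, where `η` is a smooth increasing function that vanishes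
exactly on `(-∞, 0]`, for a weakly differentiable function `w` that is negative on a sphere. -/
theorem HasWeakGradient.exists_isTestFunction_tendsto {x₀ : EuclideanSpace ℝ (Fin d)} {r p : ℝ}
    (hr : 0 < r) (hp : 1 ≤ p) {w : EuclideanSpace ℝ (Fin d) → ℝ}
    {G : EuclideanSpace ℝ (Fin d) → EuclideanSpace ℝ (Fin d)}
    (hwc : ContinuousOn w (Metric.ball x₀ (2 * r))) (hwi : IntegrableOn w (Metric.ball x₀ (2 * r)))
    (hGL : MemLp G (ENNReal.ofReal p) (volume.restrict (Metric.ball x₀ (2 * r))))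
    (hwG : HasWeakGradient (Metric.ball x₀ (2 * r)) w G)
    (hneg : ∀ x ∈ Metric.sphere x₀ r, w x < 0) :
    MemLp (fun x => deriv Real.smoothTransition (w x) • G x) (ENNReal.ofReal p)
      (volume.restrict (Metric.ball x₀ r)) ∧
    ∃ v : ℕ → EuclideanSpace ℝ (Fin d) → ℝ, (∀ n, IsTestFunction (Metric.ball x₀ r) (v n)) ∧
      (∀ n x, ‖v n x‖ ≤ 1) ∧
      (∀ x ∈ Metric.ball x₀ r,
        Tendsto (fun n => v n x) atTop (𝓝 (Real.smoothTransition (w x)))) ∧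
      Tendsto (fun n => eLpNorm
        (fun x => gradient (v n) x - deriv Real.smoothTransition (w x) • G x) (ENNReal.ofReal p)
        (volume.restrict (Metric.ball x₀ r))) atTop (𝓝 0) := by
  have hp1 : 1 ≤ ENNReal.ofReal p := by simpa using hp
  set V := Metric.ball x₀ (2 * r) with hV
  set B := Metric.ball x₀ r with hB
  set K := Metric.closedBall x₀ r with hK
  have hVo : IsOpen V := Metric.isOpen_ball
  have hBo : IsOpen B := Metric.isOpen_ball
  have hBK : B ⊆ K := Metric.ball_subset_closedBall
  have hKV : K ⊆ V := Metric.closedBall_subset_ball (by linarith)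
  have hfinV := isFiniteMeasure_restrict_ball x₀ (2 * r)
  have hGi : IntegrableOn G V := hGL.integrable hp1
  have hwi' : LocallyIntegrable (V.indicator w) volume :=
    ((integrable_indicator_iff hVo.measurableSet).2 hwi).locallyIntegrable
  have hGi' : LocallyIntegrable (V.indicator G) volume :=
    ((integrable_indicator_iff hVo.measurableSet).2 hGi).locallyIntegrable
  set wn : ℕ → EuclideanSpace ℝ (Fin d) → ℝ := fun n => mollify n (V.indicator w) with hwn
  set Gn : ℕ → EuclideanSpace ℝ (Fin d) → EuclideanSpace ℝ (Fin d) :=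
    fun n => mollify n (V.indicator G) with hGn
  have hwns : ∀ n, ContDiff ℝ ∞ (wn n) := fun n => contDiff_mollify hwi' n
  have hGns : ∀ n, Continuous (Gn n) := fun n => (contDiff_mollify hGi' n).continuous
  have hunif : TendstoUniformlyOn wn w atTop K := by
    refine (tendstoUniformlyOn_mollify hwi'.aestronglyMeasurable (isCompact_closedBall x₀ r)
      fun x hx => ?_).congr_right fun x hx => indicator_of_mem (hKV hx) _
    refine (hwc.continuousAt (hVo.mem_nhds (hKV hx))).congr ?_
    filter_upwards [hVo.mem_nhds (hKV hx)] with y hy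
    exact (indicator_of_mem hy _).symm
  have hgradn : ∀ᶠ n in atTop, ∀ x ∈ B, gradient (wn n) x = Gn n x := by
    filter_upwards [(tendsto_mollifier_rOut (d := d)).eventually_lt_const hr] with n hn x hx
    refine hwG.gradient_mollify hVo hwi hGi fun y hy => ?_
    rw [hB, Metric.mem_ball] at hx
    rw [Metric.mem_closedBall] at hy
    rw [hV, Metric.mem_ball]
    linarith [dist_triangle y x x₀]
  have hnegn : ∀ᶠ n in atTop, ∀ x ∈ Metric.sphere x₀ r, wn n x < 0 := by
    have hsK : Metric.sphere x₀ r ⊆ K := Metric.sphere_subset_closedBall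
    obtain ⟨m, hm, hmle⟩ := (isCompact_sphere x₀ r).exists_forall_le' (f := fun x => -w x)
      (hwc.neg.mono (hsK.trans hKV)) fun x hx => neg_pos.2 (hneg x hx)
    filter_upwards [Metric.tendstoUniformlyOn_iff.1 hunif m hm] with n hn x hx
    have h1 := hn x (hsK hx)
    have h2 := hmle x hx
    rw [Real.dist_eq, abs_lt] at h1
    linarith
  -- Beyond `N` the mollifications are negative on the sphere and have the expected gradient; the
  -- sequence of test functions is shifted by `N`.
  obtain ⟨N, hN⟩ := eventually_atTop.1 (hgradn.and hnegn)
  set a : EuclideanSpace ℝ (Fin d) → ℝ := fun x => deriv Real.smoothTransition (w x) with ha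
  set an : ℕ → EuclideanSpace ℝ (Fin d) → ℝ := fun n x => deriv Real.smoothTransition (wn n x)
    with han
  obtain ⟨M, hM⟩ :=
    hasCompactSupport_deriv_smoothTransition.exists_bound_of_continuous
      continuous_deriv_smoothTransition
  have hac : ContinuousOn a K := continuous_deriv_smoothTransition.comp_continuousOn
    (hwc.mono hKV)
  have hanc : ∀ n, Continuous (an n) := fun n =>
    continuous_deriv_smoothTransition.comp (hwns n).continuous
  have haunif : TendstoUniformlyOn an a atTop B :=
    ((hasCompactSupport_deriv_smoothTransition.uniformContinuous_of_continuous
      continuous_deriv_smoothTransition).comp_tendstoUniformlyOn hunif).mono hBK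
  have ham : AEStronglyMeasurable a (volume.restrict B) :=
    (hac.mono hBK).aestronglyMeasurable hBo.measurableSet
  have hGB : MemLp G (ENNReal.ofReal p) (volume.restrict B) :=
    hGL.mono_measure (Measure.restrict_mono (hBK.trans hKV) le_rfl)
  have hGnG : Tendsto (fun n => eLpNorm (fun x => Gn n x - G x) (ENNReal.ofReal p)
      (volume.restrict B)) atTop (𝓝 0) := by
    have h0 : MemLp (V.indicator G) (ENNReal.ofReal p) volume :=
      (memLp_indicator_iff_restrict hVo.measurableSet).2 hGL
    have h1 := tendsto_eLpNorm_mollify_sub hp h0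
    refine tendsto_of_tendsto_of_tendsto_of_le_of_le tendsto_const_nhds h1 (fun _ => zero_le)
      fun n => ?_
    refine le_trans (le_of_eq (eLpNorm_congr_ae ?_)) (eLpNorm_restrict_le _ _ _ B)
    filter_upwards [ae_restrict_mem hBo.measurableSet] with x hx
    rw [indicator_of_mem (hKV (hBK hx))]
  have hFlim := tendsto_eLpNorm_smul_sub (a := a) (an := an) (G := G) (Gn := Gn) (M := M) hp1
    (ae_restrict_mem hBo.measurableSet) ham
    (fun n => (hanc n).aestronglyMeasurable) (fun n x => hM (wn n x)) haunif hGB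
    (fun n => (hGns n).aestronglyMeasurable) hGnG
  refine ⟨?_, fun n => B.indicator fun x => Real.smoothTransition (wn (n + N) x), fun n => ?_,
    fun n x => ?_, fun x hx => ?_, ?_⟩
  · refine hGB.of_le_mul (c := M) (ham.smul hGB.1) (ae_of_all _ fun x => ?_)
    rw [norm_smul]
    exact mul_le_mul_of_nonneg_right (hM _) (norm_nonneg _)
  · exact isTestFunction_indicator_smoothTransition (hwns _) (hN _ (Nat.le_add_left N n)).2
  · refine (norm_indicator_le_norm_self _ _).trans ?_
    rw [Real.norm_of_nonneg (Real.smoothTransition.nonneg _)]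
    exact Real.smoothTransition.le_one _
  · simp only [indicator_of_mem hx]
    exact ((Real.smoothTransition.continuous.tendsto _).comp
      ((hunif.tendsto_at (hBK hx)).comp (tendsto_add_atTop_nat N)))
  · refine (hFlim.comp (tendsto_add_atTop_nat N)).congr fun n => eLpNorm_congr_ae ?_
    filter_upwards [ae_restrict_mem hBo.measurableSet] with x hx
    rw [gradient_indicator_smoothTransition (hwns _) hx, (hN _ (Nat.le_add_left N n)).1 x hx]

/-- A `C²` function with negative `p`-Laplacian cannot touch a weak solution strictly from above. -/
theorem false_of_touching {Ω : Set (EuclideanSpace ℝ (Fin d))} (hΩ : IsOpen Ω) {p : ℝ}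
    (hp : 2 < p) {u ψ : EuclideanSpace ℝ (Fin d) → ℝ}
    {Du : EuclideanSpace ℝ (Fin d) → EuclideanSpace ℝ (Fin d)} (hu : ContinuousOn u Ω)
    (hDu : HasWeakGradient Ω u Du) (hDuL : MemLp Du (ENNReal.ofReal p) (volume.restrict Ω))
    (heq : ∀ v, IsTestFunction Ω v → ∫ x in Ω, inner ℝ (flux p (Du x)) (gradient v x) = 0)
    (hψ : ContDiffOn ℝ 2 ψ Ω) {x₀ : EuclideanSpace ℝ (Fin d)} (hx₀ : x₀ ∈ Ω)
    (hgrad : gradient ψ x₀ ≠ 0)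
    (hdiv : ∑ i, partialDeriv i (fun y => flux p (gradient ψ y) i) x₀ < 0)
    (htouch : u x₀ = ψ x₀) (hlt : ∀ᶠ y in 𝓝[≠] x₀, u y < ψ y) : False := by
  have hp1 : 1 ≤ ENNReal.ofReal p := by simpa using by linarith
  have hg1 := contDiffOn_gradient hΩ hψ
  set U₀ := Ω ∩ gradient ψ ⁻¹' {0}ᶜ with hU₀
  have hU₀o : IsOpen U₀ := hg1.continuousOn.isOpen_inter_preimage hΩ isOpen_compl_singleton
  set X : EuclideanSpace ℝ (Fin d) → EuclideanSpace ℝ (Fin d) := fun y => flux p (gradient ψ y)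
    with hX
  have hX1 : ContDiffOn ℝ 1 X U₀ :=
    contDiffOn_flux p (hg1.mono inter_subset_left) fun x hx => hx.2
  set D : EuclideanSpace ℝ (Fin d) → ℝ := fun x => ∑ i, partialDeriv i (fun y => X y i) x with hD
  have hDc : ContinuousOn D U₀ := by
    refine continuousOn_finsetSum _ fun i _ => ?_
    have h1 : ContDiffOn ℝ 1 (fun y => X y i) U₀ :=
      (EuclideanSpace.proj (𝕜 := ℝ) i : EuclideanSpace ℝ (Fin d) →L[ℝ] ℝ).contDiff.comp_contDiffOn
        hX1
    exact (h1.continuousOn_fderiv_of_isOpen hU₀o le_rfl).clm_apply continuousOn_const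
  have hx₀U : x₀ ∈ U₀ := ⟨hx₀, hgrad⟩
  have hnhds : ∀ᶠ x in 𝓝 x₀, x ∈ U₀ ∧ D x < 0 ∧ (x ≠ x₀ → u x < ψ x) :=
    Eventually.and (hU₀o.mem_nhds hx₀U)
      (((hDc.continuousAt (hU₀o.mem_nhds hx₀U)).eventually_lt_const
      hdiv).and (eventually_nhdsWithin_iff.1 hlt))
  obtain ⟨ε, hε, hball⟩ := Metric.eventually_nhds_iff_ball.1 hnhds
  -- Testing takes place in the ball of radius `r`; the ball of radius `2r` gives the mollifiers
  -- room.
  obtain ⟨r, hr, hrε⟩ : ∃ r : ℝ, 0 < r ∧ 2 * r < ε := ⟨ε / 3, by positivity, by linarith⟩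
  set V := Metric.ball x₀ (2 * r) with hV
  set B := Metric.ball x₀ r with hB
  set K := Metric.closedBall x₀ r with hK
  have hVo : IsOpen V := Metric.isOpen_ball
  have hBo : IsOpen B := Metric.isOpen_ball
  have hBK : B ⊆ K := Metric.ball_subset_closedBall
  have hKV : K ⊆ V := Metric.closedBall_subset_ball (by linarith)
  have hV2 : Metric.closedBall x₀ (2 * r) ⊆ Metric.ball x₀ ε := Metric.closedBall_subset_ball hrε
  have hV2Ω : Metric.closedBall x₀ (2 * r) ⊆ Ω := fun x hx => (hball x (hV2 hx)).1.1
  have hVΩ : V ⊆ Ω := Metric.ball_subset_closedBall.trans hV2Ω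
  have hKU : K ⊆ U₀ := fun x hx => (hball x (hV2 (Metric.ball_subset_closedBall (hKV hx)))).1
  have hBΩ : B ⊆ Ω := (hBK.trans hKV).trans hVΩ
  have hKε : ∀ x ∈ K, D x < 0 ∧ (x ≠ x₀ → u x < ψ x) := fun x hx =>
    (hball x (hV2 (Metric.ball_subset_closedBall (hKV hx)))).2
  have hx₀B : x₀ ∈ B := Metric.mem_ball_self hr
  obtain ⟨m, hm, hmle⟩ : ∃ m, 0 < m ∧ ∀ x ∈ Metric.sphere x₀ r, m ≤ ψ x - u x := by
    have hsK : Metric.sphere x₀ r ⊆ K := Metric.sphere_subset_closedBall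
    refine (isCompact_sphere x₀ r).exists_forall_le'
      ((hψ.continuousOn.sub hu).mono (hsK.trans (hKV.trans hVΩ))) fun x hx => ?_
    refine sub_pos.2 ((hKε x (hsK hx)).2 fun h => ?_)
    rw [h, Metric.mem_sphere, dist_self] at hx
    linarith
  -- Lowering `ψ` by half the gap on the sphere gives `w(x₀) = m/2` and `w ≤ -m/2` on the sphere.
  set w : EuclideanSpace ℝ (Fin d) → ℝ := fun x => u x - (ψ x - m / 2) with hw
  set G : EuclideanSpace ℝ (Fin d) → EuclideanSpace ℝ (Fin d) := fun x => Du x - gradient ψ x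
    with hG
  have hψ' : gradient (fun x => ψ x - m / 2) = gradient ψ := by
    ext1 x
    simp [gradient, fderiv_sub_const]
  have hwc : ContinuousOn w Ω := hu.sub (hψ.continuousOn.sub continuousOn_const)
  have hGL : MemLp G (ENNReal.ofReal p) (volume.restrict V) :=
    (hDuL.mono_measure (Measure.restrict_mono hVΩ le_rfl)).sub
      (memLp_ball_of_continuousOn (hg1.continuousOn.mono hV2Ω) _)
  have hfinV := isFiniteMeasure_restrict_ball x₀ (2 * r)
  have hfinB := isFiniteMeasure_restrict_ball x₀ r
  have hGi : IntegrableOn G V := hGL.integrable hp1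
  have hwi : IntegrableOn w V :=
    (memLp_ball_of_continuousOn (hwc.mono hV2Ω) 1).integrable le_rfl
  have hwG : HasWeakGradient V w G := by
    have h1 := hasWeakGradient_of_contDiffOn hVo (f := fun x => ψ x - m / 2)
      (((hψ.sub contDiffOn_const).of_le (by norm_num)).mono hVΩ)
    rw [hψ'] at h1
    refine (hDu.mono hVΩ).sub h1 ?_ ?_ ?_ ?_
    · exact (memLp_ball_of_continuousOn (hu.mono hV2Ω) 1).integrable le_rfl
    · exact (memLp_ball_of_continuousOn
        ((hψ.continuousOn.sub continuousOn_const).mono hV2Ω) 1).integrable le_rfl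
    · exact (hDuL.mono_measure (Measure.restrict_mono hVΩ le_rfl)).integrable hp1
    · exact (memLp_ball_of_continuousOn (hg1.continuousOn.mono hV2Ω) 1).integrable le_rfl
  have hneg : ∀ x ∈ Metric.sphere x₀ r, w x < 0 := fun x hx => by
    have := hmle x hx
    simp only [hw]
    linarith
  obtain ⟨haG, v, hv, hv1, hvη, hvlim⟩ := hwG.exists_isTestFunction_tendsto hr (by linarith)
    (hwc.mono hVΩ) hwi hGL hneg
  have hDuB : MemLp (fun x => flux p (Du x)) (ENNReal.ofReal (p / (p - 1))) (volume.restrict B) :=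
    memLp_flux hp (hDuL.mono_measure (Measure.restrict_mono hBΩ le_rfl))
  have hXB : MemLp X (ENNReal.ofReal (p / (p - 1))) (volume.restrict B) :=
    memLp_ball_of_continuousOn (hX1.continuousOn.mono hKU) _
  have hconj := holderConjugate_ofReal hp
  have hvL : ∀ n, MemLp (gradient (v n)) (ENNReal.ofReal p) (volume.restrict B) := fun n =>
    memLp_ball_of_continuousOn (hv n).continuous_gradient.continuousOn _
  have hlim1 := tendsto_integral_inner (hDuB.sub hXB) haG (Eventually.of_forall hvL) hvlim
  -- The weak equation removes the flux of `u`, and the divergence theorem turns that of `ψ` into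
  -- `D`.
  have heqn : ∀ n, ∫ x in B, inner ℝ (((fun x => flux p (Du x)) - X) x) (gradient (v n) x) =
      ∫ x in B, D x * v n x := by
    intro n
    have h1 : ∫ x in B, inner ℝ (flux p (Du x)) (gradient (v n) x) = 0 := by
      rw [← setIntegral_congr_set_of_eq_zero hBΩ fun x hx => by
        rw [(hv n).gradient_eq_zero hx, inner_zero_right]]
      exact heq (v n) ((hv n).mono hBΩ)
    have h2 := integral_inner_gradient hBo (hX1.mono (hBK.trans hKU)) (hv n)
    simp only [Pi.sub_apply, inner_sub_left]
    rw [integral_sub (integrable_inner hDuB (hvL n)) (integrable_inner hXB (hvL n)), h1, h2,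
      zero_sub, neg_neg]
  have hDi : IntegrableOn D B :=
    (memLp_ball_of_continuousOn (hDc.mono hKU) 1).integrable le_rfl
  have hlim2 : Tendsto (fun n => ∫ x in B, D x * v n x) atTop
      (𝓝 (∫ x in B, D x * Real.smoothTransition (w x))) := by
    refine tendsto_integral_of_dominated_convergence (fun x => ‖D x‖)
      (fun n => hDi.aestronglyMeasurable.mul (hv n).1.continuous.aestronglyMeasurable)
      hDi.norm (fun n => ae_of_all _ fun x => ?_) ?_
    · rw [norm_mul]
      exact mul_le_of_le_one_right (norm_nonneg _) (hv1 n x)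
    · filter_upwards [ae_restrict_mem hBo.measurableSet] with x hx
      exact (hvη x hx).const_mul _
  have hfinal := tendsto_nhds_unique hlim1 (hlim2.congr fun n => (heqn n).symm)
  have hpos : 0 ≤ ∫ x in B, inner ℝ (((fun x => flux p (Du x)) - X) x)
      (deriv Real.smoothTransition (w x) • G x) := by
    refine integral_nonneg fun x => ?_
    rw [Pi.zero_apply, real_inner_smul_right]
    exact mul_nonneg (deriv_smoothTransition_nonneg _) (inner_flux_sub_nonneg hp _ _)
  have hηc : ContinuousOn (fun x => Real.smoothTransition (w x)) K :=
    Real.smoothTransition.continuous.comp_continuousOn (hwc.mono (hKV.trans hVΩ))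
  have hcneg : ContinuousOn (fun x => -(D x * Real.smoothTransition (w x))) K :=
    ((hDc.mono hKU).mul hηc).neg
  -- The integrand is nonnegative, and positive on the open set `B ∩ {w > 0}`, which contains `x₀`.
  have hstrict : 0 < ∫ x in B, -(D x * Real.smoothTransition (w x)) := by
    rw [setIntegral_pos_iff_support_of_nonneg_ae]
    · have hopen : IsOpen (B ∩ w ⁻¹' Ioi 0) := (hwc.mono hBΩ).isOpen_inter_preimage hBo isOpen_Ioi
      refine lt_of_lt_of_le (hopen.measure_pos volume ⟨x₀, hx₀B, ?_⟩) (measure_mono fun x hx => ?_)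
      · simp only [hw, mem_preimage, mem_Ioi, htouch]
        linarith
      · refine ⟨?_, hx.1⟩
        rw [Function.mem_support]
        exact neg_ne_zero.2 (mul_ne_zero (hKε x (hBK hx.1)).1.ne
          (Real.smoothTransition.pos_of_pos hx.2).ne')
    · filter_upwards [ae_restrict_mem hBo.measurableSet] with x hx
      exact neg_nonneg.2 (mul_nonpos_of_nonpos_of_nonneg (hKε x (hBK hx)).1.le
        (Real.smoothTransition.nonneg _))
    · exact (memLp_ball_of_continuousOn hcneg 1).integrable le_rfl
  rw [integral_neg] at hstrict
  linarith

/-! ### Nondivergence form, strict contact and the viscosity inequalities. -/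

/-- In nondivergence form, the `p`-Laplacian is a positive multiple of the normalised operator where
the gradient does not vanish. -/
theorem exists_sum_partialDeriv_flux_eq {p : ℝ} (hp : 2 < p) {ψ : EuclideanSpace ℝ (Fin d) → ℝ}
    {x₀ : EuclideanSpace ℝ (Fin d)} (hψ : DifferentiableAt ℝ (gradient ψ) x₀)
    (h0 : gradient ψ x₀ ≠ 0) (s : ℝ) :
    ∃ c : ℝ, 0 < c ∧ ∑ i, partialDeriv i (fun y => flux p (gradient ψ y) i) x₀ =
      -(c * normalisedOperator p s (gradient ψ x₀) (hessian ψ x₀)) := by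
  set ξ := gradient ψ x₀ with hξ
  set Y' := fderiv ℝ (gradient ψ) x₀ with hY'
  have hY : HasFDerivAt (gradient ψ) Y' x₀ := hψ.hasFDerivAt
  have hξ2 : 0 < ‖ξ‖ ^ 2 := by positivity
  have hcomp : ∀ j, HasFDerivAt (fun y => gradient ψ y j)
      ((EuclideanSpace.proj (𝕜 := ℝ) j : EuclideanSpace ℝ (Fin d) →L[ℝ] ℝ).comp Y') x₀ := fun j =>
    (EuclideanSpace.proj (𝕜 := ℝ) j : EuclideanSpace ℝ (Fin d) →L[ℝ] ℝ).hasFDerivAt.comp x₀ hY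
  have hhess : ∀ i j, Y' (EuclideanSpace.single i 1) j = hessian ψ x₀ i j := by
    intro i j
    have h1 : partialDeriv j ψ = fun y => gradient ψ y j := by
      ext y
      rw [gradient_apply]
    rw [hessian, Matrix.of_apply, h1, partialDeriv, (hcomp j).fderiv]
    rfl
  -- This is `|ξ|^{p-4}`, written through the squared norm because that is what gets differentiated.
  set c := (‖ξ‖ ^ 2) ^ ((p - 2) / 2 - 1) with hc
  have hc0 : 0 < c := by positivity
  have hcξ : ‖ξ‖ ^ (p - 2) = c * ‖ξ‖ ^ 2 := by
    rw [hc, Real.rpow_sub_one hξ2.ne', div_mul_cancel₀ _ hξ2.ne', ← Real.rpow_natCast,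
      ← Real.rpow_mul (norm_nonneg _)]
    congr 1
    push_cast
    ring
  have hpow : HasFDerivAt (fun y => ‖gradient ψ y‖ ^ (p - 2))
      (((p - 2) / 2 * c) • (2 • (innerSL ℝ ξ).comp Y')) x₀ := by
    have h1 := (hY.norm_sq).rpow_const (p := (p - 2) / 2) (Or.inl hξ2.ne')
    refine h1.congr_of_eventuallyEq (Eventually.of_forall fun y => ?_)
    dsimp only
    rw [← Real.rpow_natCast, ← Real.rpow_mul (norm_nonneg _)]
    congr 1
    push_cast
    ring
  -- Summed over `i`, this reads `|ξ|^{p-2} Δψ + (p-2) |ξ|^{p-4} Δ_∞ψ`; hence the factor `(p-2) c`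
  -- below.
  have hi : ∀ i, partialDeriv i (fun y => flux p (gradient ψ y) i) x₀ =
      c * ‖ξ‖ ^ 2 * hessian ψ x₀ i i +
        (p - 2) * c * ∑ j, ξ i * ξ j * hessian ψ x₀ i j := by
    intro i
    have h1 : HasFDerivAt (fun y => flux p (gradient ψ y) i) _ x₀ := hpow.mul (hcomp i)
    rw [partialDeriv, h1.fderiv]
    have h2 : inner ℝ ξ (Y' (EuclideanSpace.single i 1)) = ∑ j, ξ j * hessian ψ x₀ i j := by
      rw [PiLp.inner_apply]
      refine Finset.sum_congr rfl fun j _ => ?_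
      rw [← hhess]
      simp [mul_comm]
    have h3 : ∑ j, ξ i * ξ j * hessian ψ x₀ i j = ξ i * ∑ j, ξ j * hessian ψ x₀ i j := by
      rw [Finset.mul_sum]
      exact Finset.sum_congr rfl fun j _ => mul_assoc _ _ _
    rw [h3, ← h2, ← hhess, ← hcξ]
    simp [← hξ]
    ring
  refine ⟨(p - 2) * c, mul_pos (by linarith) hc0, ?_⟩
  simp_rw [hi]
  rw [Finset.sum_add_distrib, ← Finset.mul_sum, ← Finset.mul_sum, normalisedOperator, Matrix.trace]
  simp only [Matrix.diag_apply]
  have : p - 2 ≠ 0 := by linarith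
  field_simp
  ring

/-- The quartic is the perturbation that makes contact strict: it is positive off `x₀` and its
derivatives up to order two vanish there. A quadratic one would change the Hessian. -/
theorem hasFDerivAt_norm_sub_pow_four (x₀ x : EuclideanSpace ℝ (Fin d)) :
    HasFDerivAt (fun y => ‖y - x₀‖ ^ 4) ((4 * ‖x - x₀‖ ^ 2) • innerSL ℝ (x - x₀)) x := by
  have h1 := (((hasFDerivAt_id x).sub_const x₀).norm_sq).pow 2
  have h2 : (fun y : EuclideanSpace ℝ (Fin d) => ‖y - x₀‖ ^ 4) =
      fun y => (‖id y - x₀‖ ^ 2) ^ 2 := by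
    ext y
    rw [id, ← pow_mul]
  rw [h2]
  refine h1.congr_fderiv ?_
  ext v
  simp
  ring

theorem gradient_add_norm_sub_pow_four {φ : EuclideanSpace ℝ (Fin d) → ℝ}
    {x₀ : EuclideanSpace ℝ (Fin d)} (hφ : DifferentiableAt ℝ φ x₀) :
    gradient (fun y => φ y + ‖y - x₀‖ ^ 4) x₀ = gradient φ x₀ := by
  have h := hφ.hasFDerivAt.add (hasFDerivAt_norm_sub_pow_four x₀ x₀)
  have h1 : fderiv ℝ (fun y => φ y + ‖y - x₀‖ ^ 4) x₀ = fderiv ℝ φ x₀ := by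
    refine h.fderiv.trans ?_
    simp
  rw [gradient, h1, gradient]

theorem hessian_add_norm_sub_pow_four {Ω : Set (EuclideanSpace ℝ (Fin d))} (hΩ : IsOpen Ω)
    {φ : EuclideanSpace ℝ (Fin d) → ℝ} (hφ : ContDiffOn ℝ 2 φ Ω)
    {x₀ : EuclideanSpace ℝ (Fin d)} (hx₀ : x₀ ∈ Ω) :
    hessian (fun y => φ y + ‖y - x₀‖ ^ 4) x₀ = hessian φ x₀ := by
  ext i j
  rw [hessian, hessian, Matrix.of_apply, Matrix.of_apply]
  have h1 : partialDeriv j (fun y => φ y + ‖y - x₀‖ ^ 4) =ᶠ[𝓝 x₀]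
      fun x => partialDeriv j φ x + 4 * ‖x - x₀‖ ^ 2 * (x - x₀) j := by
    filter_upwards [hΩ.mem_nhds hx₀] with x hx
    have h2 : HasFDerivAt (fun y => φ y + ‖y - x₀‖ ^ 4) _ x :=
      ((hφ.differentiableOn (by norm_num)).differentiableAt (hΩ.mem_nhds hx)).hasFDerivAt.add
        (hasFDerivAt_norm_sub_pow_four x₀ x)
    rw [partialDeriv, h2.fderiv]
    simp [partialDeriv, EuclideanSpace.inner_single_right]
  have h3 : DifferentiableAt ℝ (partialDeriv j φ) x₀ :=
    ((ContDiffOn.clm_apply (hφ.fderiv_of_isOpen hΩ (m := 1) (by norm_num))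
      contDiffOn_const).differentiableOn one_ne_zero).differentiableAt (hΩ.mem_nhds hx₀)
  have h4 : HasFDerivAt (𝕜 := ℝ)
      (fun x : EuclideanSpace ℝ (Fin d) => 4 * ‖x - x₀‖ ^ 2 * (x - x₀) j) 0 x₀ := by
    have h5 : HasFDerivAt (fun x : EuclideanSpace ℝ (Fin d) => ‖x - x₀‖ ^ 2) _ x₀ :=
      ((hasFDerivAt_id (𝕜 := ℝ) x₀).sub_const x₀).norm_sq
    have h6 : HasFDerivAt (fun x : EuclideanSpace ℝ (Fin d) => (x - x₀) j)
        (EuclideanSpace.proj (𝕜 := ℝ) j : EuclideanSpace ℝ (Fin d) →L[ℝ] ℝ) x₀ :=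
      (EuclideanSpace.proj (𝕜 := ℝ) j : EuclideanSpace ℝ (Fin d) →L[ℝ] ℝ).hasFDerivAt.comp x₀
        ((hasFDerivAt_id (𝕜 := ℝ) x₀).sub_const x₀)
    refine ((h5.const_mul 4).mul h6).congr_fderiv ?_
    ext v
    simp
  have h6 : HasFDerivAt
      (fun x => partialDeriv j φ x + 4 * ‖x - x₀‖ ^ 2 * (x - x₀) j) _ x₀ := h3.hasFDerivAt.add h4
  rw [partialDeriv, h1.fderiv_eq, h6.fderiv, add_zero, partialDeriv]

theorem contDiff_norm_sub_pow_four (x₀ : EuclideanSpace ℝ (Fin d)) :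
    ContDiff ℝ 2 fun y : EuclideanSpace ℝ (Fin d) => ‖y - x₀‖ ^ 4 := by
  have h : (fun y : EuclideanSpace ℝ (Fin d) => ‖y - x₀‖ ^ 4) = fun y => (‖y - x₀‖ ^ 2) ^ 2 := by
    ext y
    rw [← pow_mul]
  rw [h]
  exact ((contDiff_id.sub contDiff_const).norm_sq ℝ).pow 2

/-- Continuous weak solutions of the `p`-Laplace equation are viscosity subsolutions. -/
theorem isViscositySubsolutionAt_of_weak {Ω : Set (EuclideanSpace ℝ (Fin d))} (hΩ : IsOpen Ω)
    {p : ℝ} (hp : 2 < p) {u : EuclideanSpace ℝ (Fin d) → ℝ}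
    {Du : EuclideanSpace ℝ (Fin d) → EuclideanSpace ℝ (Fin d)} (hu : ContinuousOn u Ω)
    (hDu : HasWeakGradient Ω u Du) (hDuL : MemLp Du (ENNReal.ofReal p) (volume.restrict Ω))
    (heq : ∀ v, IsTestFunction Ω v → ∫ x in Ω, inner ℝ (flux p (Du x)) (gradient v x) = 0)
    {x₀ : EuclideanSpace ℝ (Fin d)} (hx₀ : x₀ ∈ Ω) :
    IsViscositySubsolutionAt Ω (normalisedOperator p) u x₀ := by
  intro φ hφ htouch hle
  by_contra! hF
  set ψ : EuclideanSpace ℝ (Fin d) → ℝ := fun y => φ y + ‖y - x₀‖ ^ 4 with hψ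
  have hψ2 : ContDiffOn ℝ 2 ψ Ω := hφ.add (contDiff_norm_sub_pow_four x₀).contDiffOn
  have hgrad : gradient ψ x₀ = gradient φ x₀ := gradient_add_norm_sub_pow_four
    ((hφ.differentiableOn (by norm_num)).differentiableAt (hΩ.mem_nhds hx₀))
  have hhess : hessian ψ x₀ = hessian φ x₀ := hessian_add_norm_sub_pow_four hΩ hφ hx₀
  -- At zero gradient the operator is `0`, so the viscosity inequality could not fail.
  have h0 : gradient ψ x₀ ≠ 0 := by
    intro h
    rw [← hgrad, h] at hF
    simp [normalisedOperator] at hF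
  obtain ⟨c, hc, hceq⟩ := exists_sum_partialDeriv_flux_eq hp
    (((contDiffOn_gradient hΩ hψ2).differentiableOn one_ne_zero).differentiableAt
      (hΩ.mem_nhds hx₀)) h0 (φ x₀)
  refine false_of_touching hΩ hp hu hDu hDuL heq hψ2 hx₀ h0 ?_ ?_ ?_
  · rw [hceq, hgrad, hhess]
    exact neg_neg_of_pos (mul_pos hc hF)
  · simp [hψ, htouch]
  · rw [eventually_nhdsWithin_iff]
    filter_upwards [hle] with y hy hne
    have : 0 < ‖y - x₀‖ ^ 4 := by
      have := norm_pos_iff.2 (sub_ne_zero.2 hne)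
      positivity
    simp only [hψ]
    linarith

theorem partialDeriv_neg (i : Fin d) (f : EuclideanSpace ℝ (Fin d) → ℝ) :
    partialDeriv i (-f) = -partialDeriv i f := by
  ext x
  simp [partialDeriv, fderiv_neg]

theorem gradient_neg (f : EuclideanSpace ℝ (Fin d) → ℝ) (x : EuclideanSpace ℝ (Fin d)) :
    gradient (-f) x = -gradient f x := by
  simp [gradient, fderiv_neg]

theorem hessian_neg (f : EuclideanSpace ℝ (Fin d) → ℝ) (x : EuclideanSpace ℝ (Fin d)) :
    hessian (-f) x = -hessian f x := by
  ext i j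
  simp [hessian, partialDeriv_neg]

/-- The operator is quadratic in `ξ` and linear in `X`, hence odd under the joint sign change. The
values `r` and `s` may differ since it ignores that argument. -/
theorem normalisedOperator_neg (p r s : ℝ) (ξ : EuclideanSpace ℝ (Fin d))
    (X : Matrix (Fin d) (Fin d) ℝ) :
    normalisedOperator p r (-ξ) (-X) = -normalisedOperator p s ξ X := by
  simp [normalisedOperator, Finset.sum_neg_distrib, add_comm]

/-- Continuous weak solutions of the `p`-Laplace equation are viscosity supersolutions. -/
theorem isViscositySupersolutionAt_of_weak {Ω : Set (EuclideanSpace ℝ (Fin d))} (hΩ : IsOpen Ω)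
    {p : ℝ} (hp : 2 < p) {u : EuclideanSpace ℝ (Fin d) → ℝ}
    {Du : EuclideanSpace ℝ (Fin d) → EuclideanSpace ℝ (Fin d)} (hu : ContinuousOn u Ω)
    (hDu : HasWeakGradient Ω u Du) (hDuL : MemLp Du (ENNReal.ofReal p) (volume.restrict Ω))
    (heq : ∀ v, IsTestFunction Ω v → ∫ x in Ω, inner ℝ (flux p (Du x)) (gradient v x) = 0)
    {x₀ : EuclideanSpace ℝ (Fin d)} (hx₀ : x₀ ∈ Ω) :
    IsViscositySupersolutionAt Ω (normalisedOperator p) u x₀ := by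
  intro φ hφ htouch hle
  -- The flux is odd, so `-u` solves the same equation and `-φ` touches it from above.
  have h := isViscositySubsolutionAt_of_weak hΩ hp hu.neg hDu.neg hDuL.neg
    (fun v hv => by simpa [flux_neg, integral_neg] using heq v hv) hx₀ (-φ) hφ.neg
    (by simp [htouch]) (by
      filter_upwards [hle] with y hy
      simp only [Pi.neg_apply]
      linarith)
  rw [gradient_neg, hessian_neg, normalisedOperator_neg p _ (φ x₀)] at h
  linarith

end PLaplace

end

/-! ### Assembly. -/

theorem mainTheorem3 (d : ℕ) (hd : 2 ≤ d) (p : ℝ) (hp : (d : ℝ) < p)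
    (Ω : Set (EuclideanSpace ℝ (Fin d))) (hΩ : IsOpen Ω) (hΩb : Bornology.IsBounded Ω)
    (g : EuclideanSpace ℝ (Fin d) → ℝ) (hg : PLaplace.MemSobolev Ω ∞ g)
    (u : EuclideanSpace ℝ (Fin d) → ℝ) (hu : PLaplace.IsWeakSolution Ω p g u) :
    ∃ u' g' : EuclideanSpace ℝ (Fin d) → ℝ,
      u' =ᵐ[volume.restrict Ω] u ∧
      g' =ᵐ[volume.restrict Ω] g ∧ ContinuousOn g' Ω ∧
      PLaplace.IsViscositySolution Ω (PLaplace.normalisedOperator p) u' ∧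
      ∀ y ∈ frontier Ω, Tendsto (fun x => u' x - g' x) (𝓝[Ω] y) (𝓝 0) := by
  have hd' : (2 : ℝ) ≤ d := by exact_mod_cast hd
  have hp2 : 2 < p := by linarith
  obtain ⟨⟨-, hu0⟩, Du, hDu, hDuL, heq⟩ := hu
  obtain ⟨g', hg', hg'c⟩ := hg.exists_continuousOn hΩ hΩb
  obtain ⟨w', hw'c, hw', hw'0⟩ := hu0.exists_continuous hΩb hd hp
  have hu'c : ContinuousOn (fun x => w' x + g' x) Ω := hw'c.continuousOn.add hg'c
  have hu' : (fun x => w' x + g' x) =ᵐ[volume.restrict Ω] u := by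
    filter_upwards [hw', hg'] with x hx1 hx2
    rw [hx1, hx2, sub_add_cancel]
  have hDu' : PLaplace.HasWeakGradient Ω (fun x => w' x + g' x) Du :=
    hDu.congr_ae hu'.symm (hu'c.locallyIntegrableOn hΩ.measurableSet)
  have heq' : ∀ v, PLaplace.IsTestFunction Ω v →
      ∫ x in Ω, inner ℝ (PLaplace.flux p (Du x)) (gradient v x) = 0 := fun v hv =>
    heq v (gradient v) (hv.memSobolevZero hΩ _)
      (PLaplace.hasWeakGradient_of_contDiffOn hΩ (hv.1.of_le (by simp)).contDiffOn)
  refine ⟨fun x => w' x + g' x, g', hu', hg', hg'c, ⟨hu'c, fun x hx =>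
    ⟨PLaplace.isViscositySubsolutionAt_of_weak hΩ hp2 hu'c hDu' hDuL heq' hx,
      PLaplace.isViscositySupersolutionAt_of_weak hΩ hp2 hu'c hDu' hDuL heq' hx⟩⟩, fun y hy => ?_⟩
  -- As `Ω` is open, `y ∉ Ω`; since `w'` is continuous on the whole space, no regularity of the
  -- boundary is needed.
  have hy0 : w' y = 0 := hw'0 y fun h => by
    rw [hΩ.frontier_eq] at hy
    exact hy.2 h
  simp only [add_sub_cancel_right]
  exact hy0 ▸ (hw'c.tendsto y).mono_left nhdsWithin_le_nhds
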